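/- Let $\mathbf e=(e_1,\dots,e_{q_1})$ and $\mathbf f=(f_1,\dots,f_{q_2})$ be two finite sequences of positive integers that are disjoint ($e_i\neq f_j$ for all $i,j$) and satisfy $\sum_i e_i=\sum_j f_j$. Put $M_{\mathbf e,\mathbf f}:=\max(e_1,\dots,e_{q_1},f_1,\dots,f_{q_2})$, $$\mathcal Q_{\mathbf e,\mathbf f}(n):=\frac{(e_1n)!\cdots(e_{q_1}n)!}{(f_1n)!\cdots(f_{q_2}n)!},\qquad \Delta_{\mathbf e,\mathbf f}(x):=\sum_{i=1}^{q_1}\lfloor e_ix\rfloor-\sum_{j=1}^{q_2}\lfloor f_jx\rfloor\quad(x\in\mathbb R),$$ and, with $H_n:=\sum_{i=1}^n\frac1i$, define the formal power series $$F_{\mathbf e,\mathbf f}(z):=\sum_{n\ge 0}\mathcal Q_{\mathbf e,\mathbf f}(n)z^n,\qquad G_{\mathbf e,\mathbf f}(z):=\sum_{n\ge1}\mathcal Q_{\mathbf e,\mathbf f}(n)\Big(\sum_{i=1}^{q_1}e_iH_{e_in}-\sum_{j=1}^{q_2}f_jH_{f_jn}\Big)z^n,$$ $$q_{\mathbf e,\mathbf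 f}(z):=z\exp\big(G_{\mathbf e,\mathbf f}(z)/F_{\mathbf e,\mathbf f}(z)\big).$$ For every term $L$ of $\mathbf e$ or $\mathbf f$, let $D_L$ be the least common multiple of the integers $1,2,\dots,\lfloor M_{\mathbf e,\mathbf f}/L\rfloor$. Assume that $\Delta_{\mathbf e,\mathbf f}(x)\ge1$ for all real $x\in[1/M_{\mathbf e,\mathbf f},1)$. Let $\theta\ge1$ be a divisor of $M_{\mathbf e,\mathbf f}$ such that, for every term $L$ of $\mathbf e$ or $\mathbf f$, the integer $\theta/\gcd(L,\theta)$ divides $D_L$. Then $$\big(z^{-1}q_{\mathbf e,\mathbf f}(z)\big)^{1/\theta}\in\mathbb Z[[z]],$$ where the left-hand side denotes the unique power series with constant term $1$ whose $\theta$-th power is $z^{-1}q_{\mathbf e,\mathbf f}(z)$. -/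

import Mathlib

open PowerSeries

/-! Two finite sequences of natural numbers are given as families
`e : Fin q₁ → ℕ` and `f : Fin q₂ → ℕ`. -/

/-- `M_{e,f}`: the largest of all the terms of `e` and `f`
(`0` if both sequences are empty). -/
def maxTerm {q₁ q₂ : ℕ} (e : Fin q₁ → ℕ) (f : Fin q₂ → ℕ) : ℕ :=
  max (Finset.univ.sup e) (Finset.univ.sup f)

/-- `𝒬_{e,f}(n) = ∏ᵢ (eᵢ n)! / ∏ⱼ (fⱼ n)!`, a rational number. -/
def factorialRatio {q₁ q₂ : ℕ} (e : Fin q₁ → ℕ) (f : Fin q₂ → ℕ) (n : ℕ) : ℚ :=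
  (∏ i, ((e i * n).factorial : ℚ)) / ∏ j, ((f j * n).factorial : ℚ)

/-- `F_{e,f}(z) = ∑_{n ≥ 0} 𝒬_{e,f}(n) zⁿ`. -/
def seriesF {q₁ q₂ : ℕ} (e : Fin q₁ → ℕ) (f : Fin q₂ → ℕ) : ℚ⟦X⟧ :=
  PowerSeries.mk fun n => factorialRatio e f n

/-- `G_{e,f}(z) = ∑_{n ≥ 1} 𝒬_{e,f}(n) (∑ᵢ eᵢ H_{eᵢ n} - ∑ⱼ fⱼ H_{fⱼ n}) zⁿ`, where `H` denotes
the harmonic numbers. The term of index `n = 0` vanishes because `H₀ = 0`. -/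
def seriesG {q₁ q₂ : ℕ} (e : Fin q₁ → ℕ) (f : Fin q₂ → ℕ) : ℚ⟦X⟧ :=
  PowerSeries.mk fun n => factorialRatio e f n *
    ((∑ i, (e i : ℚ) * harmonic (e i * n)) - ∑ j, (f j : ℚ) * harmonic (f j * n))

/-- `F_{e,f}` has constant term `1`, so that its inverse in `ℚ⟦X⟧` is a true inverse. -/
theorem constantCoeff_seriesF {q₁ q₂ : ℕ} (e : Fin q₁ → ℕ) (f : Fin q₂ → ℕ) :
    constantCoeff (seriesF e f) = 1 := by
  rw [← coeff_zero_eq_constantCoeff_apply]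
  simp [seriesF, factorialRatio]

/-- `G_{e,f} / F_{e,f}` has no constant term, so that it may be substituted into `exp`. -/
theorem hasSubst_seriesG_div_seriesF {q₁ q₂ : ℕ} (e : Fin q₁ → ℕ) (f : Fin q₂ → ℕ) :
    HasSubst (seriesG e f * (seriesF e f)⁻¹) := by
  apply HasSubst.of_constantCoeff_zero'
  have h : constantCoeff (seriesG e f) = 0 := by
    rw [← coeff_zero_eq_constantCoeff_apply]
    simp [seriesG]
  rw [map_mul, h, zero_mul]

/-- The canonical coordinate `q_{e,f}(z) = z exp (G_{e,f}(z) / F_{e,f}(z))`. -/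
noncomputable def canonicalCoordinate {q₁ q₂ : ℕ} (e : Fin q₁ → ℕ) (f : Fin q₂ → ℕ) : ℚ⟦X⟧ :=
  X * ((PowerSeries.exp ℚ).subst (seriesG e f * (seriesF e f)⁻¹) : ℚ⟦X⟧)

/-- The Landau function `Δ_{e,f}(x) = ∑ᵢ ⌊eᵢ x⌋ - ∑ⱼ ⌊fⱼ x⌋`. -/
noncomputable def landau {q₁ q₂ : ℕ} (e : Fin q₁ → ℕ) (f : Fin q₂ → ℕ) (x : ℝ) : ℤ :=
  (∑ i, ⌊(e i : ℝ) * x⌋) - ∑ j, ⌊(f j : ℝ) * x⌋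

/-- `D_L`: the least common multiple of the integers from `1` to `⌊M_{e,f} / L⌋`
(natural-number division is the floor of the quotient). -/
def lcmUpTo {q₁ q₂ : ℕ} (e : Fin q₁ → ℕ) (f : Fin q₂ → ℕ) (L : ℕ) : ℕ :=
  (Finset.Icc 1 (maxTerm e f / L)).lcm id

/-- `u^(1/θ) ∈ ℤ⟦X⟧` for a series `u ∈ ℚ⟦X⟧` with constant term `1` and `θ ≥ 1`: the unique
series with constant term `1` whose `θ`-th power is `u` has integer coefficients. -/
def HasIntegralRoot (θ : ℕ) (u : ℚ⟦X⟧) : Prop :=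
  ∃ r : ℤ⟦X⟧, constantCoeff r = 1 ∧ (PowerSeries.map (Int.castRingHom ℚ) r) ^ θ = u

/-! The root is `exp h` with `h = θ⁻¹ G / F`. Dwork's criterion `exists_int_coeff_exp_subst` reduces
its integrality to `h(z^p) - p h(z) ∈ p ℤ_p⟦z⟧` for every prime `p`. Since `F` has constant term `1`
and `p`-integral coefficients, one may multiply by `F(z) F(z^p)`.

Write `A` for the factorial ratio and split `G` by its terms `L`. The coefficient of `z^(a + K p)`,
`a < p`, becomes a signed sum of `(L / θ) T(L)`, where `T(L) = ∑_j A(K - j) A(a + j p) (H_{L(K - j)}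
- p H_{L(a + j p)})`. Let `p^λ` be the `p`-part of `θ / gcd(L, θ)`. Division by `θ` costs at most
`λ`, so `p^(λ + 1) ∣ T(L)` suffices. The condition on `D_L` enters only through `p^λ L ≤ M`.

Let `μ(m)` be the number of `l ≥ 1` with `{m / p^l} ≥ 1 / M`. Legendre's formula and the hypothesis
on `Δ` give `v_p(A(m)) ≥ μ(m)`. Up to a multiple of `p^(λ + 1)`, `p H_{L(a + j p)}` may be replaced
by `H_{L j}`. What remains is a sum of `H_{L j}` against a summand antisymmetric under `j ↦ K - j`.
Summation by parts along the base `p` digits of `j` turns it into products of two factors: a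
harmonic increment of valuation at least `λ - s - μ(m)` (`harmonic_sub_dvd`), and a sum of the
antisymmetric terms over `⌊j / p^s⌋ = m`, of valuation at least `s + 1 + μ(m)`
(`DworkHypotheses.dworkSum_dvd`).

The second bound is a version of Dwork's formal congruences. The usual congruence between `A(n + m
p^(s + 1)) / A(n)` and `A(⌊n / p⌋ + m p^s) / A(⌊n / p⌋)` is used only for `n` with no exceptional
leading segment, that is, no segment of `t` digits whose fractional parts at all levels `1, …, t`
are at least `1 / M`. An exceptional segment instead raises `μ` by its length, which makes its
contribution negligible. Both this bound and the harmonic one rest on `exceptional_of_pow_dvd`: high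
divisibility by `p` in a short interval forces large fractional parts. -/

/-- `p ^ k` divides the rational number `x` in the ring of `p`-integral rationals. -/
def PDvd (p : ℕ) (k : ℤ) (x : ℚ) : Prop := padicNorm p x ≤ (p : ℚ) ^ (-k)

/-! ### Calculus of `p`-adic divisibility in `ℚ`. -/

namespace PDvd

variable {p : ℕ} {k l : ℤ} {x y : ℚ}

theorem neg (hx : PDvd p k x) : PDvd p k (-x) := by
  simpa [PDvd, padicNorm.neg] using hx

variable [hp : Fact p.Prime]

theorem zero (k : ℤ) : PDvd p k 0 := by
  have : (0 : ℚ) < p := by exact_mod_cast hp.out.pos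
  simp only [PDvd, padicNorm.zero]; positivity

theorem mono (h : PDvd p k x) (hl : l ≤ k) : PDvd p l x := by
  have : (1 : ℚ) ≤ p := by exact_mod_cast hp.out.one_le
  exact le_trans h (zpow_le_zpow_right₀ this (by omega))

theorem add (hx : PDvd p k x) (hy : PDvd p k y) : PDvd p k (x + y) :=
  le_trans padicNorm.nonarchimedean (max_le hx hy)

theorem sub (hx : PDvd p k x) (hy : PDvd p k y) : PDvd p k (x - y) := by
  rw [sub_eq_add_neg]; exact hx.add hy.neg

theorem mul (hx : PDvd p k x) (hy : PDvd p l y) : PDvd p (k + l) (x * y) := by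
  have h0 : (p : ℚ) ≠ 0 := by exact_mod_cast hp.out.ne_zero
  unfold PDvd at *
  rw [padicNorm.mul, neg_add, zpow_add₀ h0]
  exact mul_le_mul hx hy (padicNorm.nonneg _) (le_trans (padicNorm.nonneg _) hx)

theorem mul_left (hx : PDvd p k x) (hy : PDvd p 0 y) : PDvd p k (y * x) := by
  simpa using hy.mul hx

theorem mul_right (hx : PDvd p k x) (hy : PDvd p 0 y) : PDvd p k (x * y) := by
  simpa using hx.mul hy

theorem sum {ι : Type*} {s : Finset ι} {F : ι → ℚ} (h : ∀ i ∈ s, PDvd p k (F i)) :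
    PDvd p k (∑ i ∈ s, F i) := by
  classical
  induction s using Finset.induction_on with
  | empty => simpa using zero k
  | insert a s ha ih =>
    rw [Finset.sum_insert ha]
    exact (h a (by simp)).add (ih fun i hi => h i (by simp [hi]))

theorem intCast (z : ℤ) : PDvd p 0 (z : ℚ) := by
  simpa [PDvd] using padicNorm.of_int z

theorem natCast (n : ℕ) : PDvd p 0 (n : ℚ) := by
  exact_mod_cast intCast (p := p) n

theorem one : PDvd p 0 (1 : ℚ) := by exact_mod_cast natCast (p := p) 1

theorem intCast_iff {n : ℕ} {z : ℤ} : PDvd p n (z : ℚ) ↔ ((p ^ n : ℕ) : ℤ) ∣ z :=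
  padicNorm.dvd_iff_norm_le.symm

theorem natCast_of_dvd {n m : ℕ} (h : p ^ n ∣ m) : PDvd p n (m : ℚ) := by
  have := (intCast_iff (p := p) (n := n) (z := m)).2 (by exact_mod_cast h)
  exact_mod_cast this

theorem prime_pow (n : ℕ) : PDvd p n ((p : ℚ) ^ n) := by
  exact_mod_cast natCast_of_dvd (p := p) (n := n) dvd_rfl

theorem prime : PDvd p 1 (p : ℚ) := by
  simpa using prime_pow (p := p) 1

theorem of_mul_prime_pow {n : ℕ} (h : PDvd p k ((p : ℚ) ^ n * x)) : PDvd p (k - n) x := by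
  have h0 : (0 : ℚ) < p := by exact_mod_cast hp.out.pos
  have hpn : padicNorm p ((p : ℚ) ^ n) = (p : ℚ) ^ (-(n : ℤ)) := by
    rw [show ((p : ℚ) ^ n) = ((p : ℚ) ^ (n : ℤ)) by simp]
    simp [h0.ne', zpow_neg]
  unfold PDvd at *
  rw [padicNorm.mul, hpn, show -k = -(n : ℤ) + -(k - n) by ring, zpow_add₀ h0.ne'] at h
  exact le_of_mul_le_mul_left h (by positivity)

theorem pow (hx : PDvd p 0 x) (n : ℕ) : PDvd p 0 (x ^ n) := by
  induction n with
  | zero => simpa using one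
  | succ n ih => rw [pow_succ]; exact ih.mul_left hx |> fun h => by simpa [mul_comm] using h

theorem prod {ι : Type*} {s : Finset ι} {F : ι → ℚ} (h : ∀ i ∈ s, PDvd p 0 (F i)) :
    PDvd p 0 (∏ i ∈ s, F i) := by
  classical
  induction s using Finset.induction_on with
  | empty => simpa using one
  | insert a s ha ih =>
    rw [Finset.prod_insert ha]
    exact (ih fun i hi => h i (by simp [hi])).mul_left (h a (by simp))

theorem mul_sub_mul {x' y' : ℚ} (hx : PDvd p 0 x) (hy' : PDvd p 0 y') (h : PDvd p k (x - x'))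
    (h' : PDvd p k (y - y')) : PDvd p k (x * y - x' * y') := by
  rw [show x * y - x' * y' = x * (y - y') + (x - x') * y' by ring]
  exact (h'.mul_left hx).add (h.mul_right hy')

theorem prod_sub_prod {ι : Type*} {s : Finset ι} {F G : ι → ℚ} (hF : ∀ i ∈ s, PDvd p 0 (F i))
    (hG : ∀ i ∈ s, PDvd p 0 (G i)) (h : ∀ i ∈ s, PDvd p k (F i - G i)) :
    PDvd p k (∏ i ∈ s, F i - ∏ i ∈ s, G i) := by
  classical
  induction s using Finset.induction_on with
  | empty => simpa using zero k
  | insert a s ha ih =>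
    rw [Finset.prod_insert ha, Finset.prod_insert ha]
    exact mul_sub_mul (hF a (by simp)) (prod fun i hi => hG i (by simp [hi])) (h a (by simp))
      (ih (fun i hi => hF i (by simp [hi])) (fun i hi => hG i (by simp [hi]))
        fun i hi => h i (by simp [hi]))

/-- If `p ^ t` exactly divides `m`, then `1 / m` has valuation `-t`. -/
theorem inv_natCast {m : ℕ} {t : ℕ} (hm : m ≠ 0) (h : ¬ p ^ (t + 1) ∣ m) :
    PDvd p (-t) ((m : ℚ)⁻¹) := by
  have h1 : (1 : ℚ) < p := by exact_mod_cast hp.out.one_lt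
  have hm0 : (m : ℚ) ≠ 0 := by exact_mod_cast hm
  unfold PDvd
  rw [padicNorm.eq_zpow_of_nonzero (inv_ne_zero hm0), padicValRat.inv, padicValRat.of_nat]
  apply zpow_le_zpow_right₀ h1.le
  have : padicValNat p m < t + 1 := by
    by_contra hc
    exact h ((padicValNat_dvd_iff_le hm).2 (by omega))
  omega

theorem div_of_unit (hx : PDvd p k x) {u : ℚ} (hu : padicNorm p u = 1) : PDvd p k (x / u) := by
  unfold PDvd at *
  rwa [padicNorm.div, hu, div_one]

/-- The valuation form of divisibility for nonzero rationals. -/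
theorem of_le_padicValRat (h : x ≠ 0 → k ≤ padicValRat p x) : PDvd p k x := by
  by_cases hx : x = 0
  · subst hx; exact zero k
  have h1 : (1 : ℚ) < p := by exact_mod_cast hp.out.one_lt
  unfold PDvd
  rw [padicNorm.eq_zpow_of_nonzero hx]
  exact zpow_le_zpow_right₀ h1.le (by have := h hx; omega)

end PDvd

/-- A rational number that is `p`-integral for all primes `p` is an integer. -/
theorem exists_intCast_eq_of_forall_pDvd {x : ℚ} (h : ∀ p : ℕ, p.Prime → PDvd p 0 x) :
    ∃ z : ℤ, (z : ℚ) = x := by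
  refine ⟨x.num, ?_⟩
  have hden : x.den = 1 := by
    by_contra hd
    obtain ⟨p, hp, hpd⟩ := Nat.exists_prime_and_dvd hd
    have : Fact p.Prime := ⟨hp⟩
    have hx : x ≠ 0 := by rintro rfl; simp at hd
    have hnum : ¬ (p : ℤ) ∣ x.num := by
      intro hc
      have := Nat.dvd_gcd (Int.natCast_dvd.1 hc) hpd
      rw [x.reduced] at this
      exact hp.one_lt.ne' (Nat.dvd_one.1 this)
    have h1 := h p hp
    unfold PDvd at h1
    rw [← Rat.num_div_den x, padicNorm.div, (padicNorm.int_eq_one_iff _).2 hnum, neg_zero,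
      zpow_zero, one_div] at h1
    have h2 := (padicNorm.nat_lt_one_iff (p := p) x.den).2 hpd
    have h3 : 0 < padicNorm p (x.den : ℚ) :=
      lt_of_le_of_ne (padicNorm.nonneg _) (padicNorm.nonzero (by exact_mod_cast x.den_nz)).symm
    exact absurd h1 (not_le.2 ((one_lt_inv₀ h3).2 h2))
  rw [← Rat.num_div_den x, hden]; simp

theorem sum_range_mul_eq {R : Type*} [AddCommMonoid R] (g : ℕ → R) (m n : ℕ) :
    ∑ i ∈ Finset.range (m * n), g i =
      ∑ b ∈ Finset.range m, ∑ i ∈ Finset.range n, g (i + b * n) := by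
  induction m with
  | zero => simp
  | succ m ih =>
    rw [Finset.sum_range_succ, ← ih, Nat.succ_mul, Finset.sum_range_add]
    simp only [add_comm]

/-! ### Dwork's formal congruences with exceptional digit strings. -/

/-- A string `c` of `r` digits in base `p` none of whose leading segments is exceptional. -/
def RegularDigits (p : ℕ) (Bad : ℕ → ℕ → Prop) : ℕ → ℕ → Prop
  | 0, _ => True
  | r + 1, c => RegularDigits p Bad r (c / p) ∧ ¬ Bad (r + 1) c

/-- The hypotheses of the formal congruence theorem of Dwork, with a set `Bad` of exceptional
strings of digits. -/
structure DworkHypotheses (p : ℕ) (Bad : ℕ → ℕ → Prop) (A : ℕ → ℚ) (μ : ℕ → ℕ) : Prop where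
  map_zero : A 0 = 1
  ne_zero : ∀ n, A n ≠ 0
  dvd : ∀ n, PDvd p (μ n) (A n)
  gain : ∀ t n m, n < p ^ t → Bad t n → t + μ m ≤ μ (n + m * p ^ t)
  dvd_ratio : ∀ s u m, u < p ^ s → RegularDigits p Bad s u → PDvd p (μ m) (A (u + m * p ^ s) / A u)
  congr_ratio : ∀ s n m, n < p ^ (s + 1) → RegularDigits p Bad (s + 1) n →
    PDvd p ((s + 1 : ℕ) + μ m - μ n)
      (A (n + m * p ^ (s + 1)) / A n - A (n / p + m * p ^ s) / A (n / p))

/-- The antisymmetric summand of the formal congruences. -/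
def dworkTerm (p : ℕ) (A : ℕ → ℚ) (a K j : ℕ) : ℚ :=
  if j ≤ K then A (a + j * p) * A (K - j) - A j * A (a + (K - j) * p) else 0

/-- The sum of `dworkTerm` over the integers `j` with `⌊j / p ^ s⌋ = m`. -/
def dworkSum (p : ℕ) (A : ℕ → ℚ) (a K s m : ℕ) : ℚ :=
  ∑ i ∈ Finset.range (p ^ s), dworkTerm p A a K (i + m * p ^ s)

section

variable {p : ℕ} {A : ℕ → ℚ} {a : ℕ}

theorem dworkSum_zero (K m : ℕ) : dworkSum p A a K 0 m = dworkTerm p A a K m := by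
  simp [dworkSum]

theorem dworkSum_succ (K s m : ℕ) :
    dworkSum p A a K (s + 1) m = ∑ b ∈ Finset.range p, dworkSum p A a K s (b + m * p) := by
  unfold dworkSum
  rw [pow_succ', sum_range_mul_eq]
  refine Finset.sum_congr rfl fun b _ => Finset.sum_congr rfl fun i _ => ?_
  congr 1; ring

theorem dworkSum_eq_zero_of_lt {K s m : ℕ} (h : K < m * p ^ s) : dworkSum p A a K s m = 0 := by
  refine Finset.sum_eq_zero fun i _ => ?_
  rw [dworkTerm, if_neg (by omega)]

/-- The reflection `j ↦ K - j` changes the sign of the summand. -/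
theorem sum_dworkTerm_eq_zero (K N : ℕ) (hN : K < N) :
    ∑ j ∈ Finset.range N, dworkTerm p A a K j = 0 := by
  have h1 : ∑ j ∈ Finset.range N, dworkTerm p A a K j =
      ∑ j ∈ Finset.range (K + 1), dworkTerm p A a K j := by
    symm
    refine Finset.sum_subset (Finset.range_mono hN) fun j _ hj => ?_
    rw [dworkTerm, if_neg (by simpa using hj)]
  rw [h1]
  have h2 : ∀ j ∈ Finset.range (K + 1), dworkTerm p A a K j =
      A (a + j * p) * A (K - j) - A (a + (K - j) * p) * A (K - (K - j)) := by
    intro j hj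
    have hj' : j ≤ K := by simpa [Nat.lt_succ_iff] using hj
    rw [dworkTerm, if_pos hj', Nat.sub_sub_self hj']; ring
  rw [Finset.sum_congr rfl h2, Finset.sum_sub_distrib,
    Finset.sum_flip (fun j => A (a + j * p) * A (K - j)), sub_self]

theorem sum_dworkSum_eq_zero (hp : 0 < p) (K s : ℕ) :
    ∑ m ∈ Finset.range (K + 1), dworkSum p A a K s m = 0 := by
  rw [← sum_dworkTerm_eq_zero (p := p) (A := A) (a := a) K ((K + 1) * p ^ s),
    sum_range_mul_eq]
  · rfl
  · have := Nat.le_mul_of_pos_right (K + 1) (pow_pos hp s)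
    omega

end

namespace DworkHypotheses

variable {p : ℕ} {Bad : ℕ → ℕ → Prop} {A : ℕ → ℚ} {μ : ℕ → ℕ}

open Classical in
/-- The part of `dworkSum` that comes from regular strings of `r` leading digits. -/
noncomputable def regularSum (p : ℕ) (Bad : ℕ → ℕ → Prop) (A : ℕ → ℚ) (a K r u m : ℕ) : ℚ :=
  ∑ c ∈ Finset.range (p ^ r),
    if RegularDigits p Bad r c then dworkSum p A a K u (c + m * p ^ r) else 0

open Classical in
/-- The sum `regularSum` after the leading digits `m` have been split off. -/
noncomputable def splitSum (p : ℕ) (Bad : ℕ → ℕ → Prop) (A : ℕ → ℚ) (a K r u m : ℕ) : ℚ :=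
  ∑ c ∈ Finset.range (p ^ r),
    if RegularDigits p Bad r c then A (c + m * p ^ r) / A c * dworkSum p A a K u c else 0

theorem regularSum_zero (K s m : ℕ) :
    regularSum p Bad A a K 0 s m = dworkSum p A a K s m := by
  simp [regularSum, RegularDigits]

theorem splitSum_zero (h : DworkHypotheses p Bad A μ) (a K s m : ℕ) :
    splitSum p Bad A a K 0 s m = A m * dworkSum p A a K s 0 := by
  simp [splitSum, RegularDigits, h.map_zero]

variable [hp : Fact p.Prime]

theorem integral (h : DworkHypotheses p Bad A μ) (n : ℕ) : PDvd p 0 (A n) :=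
  (h.dvd n).mono (by positivity)

theorem digit_div {b c : ℕ} (hb : b < p) : (b + c * p) / p = c := by
  rw [Nat.add_mul_div_right _ _ hp.out.pos, Nat.div_eq_of_lt hb, zero_add]

/-- Splitting off one more digit changes the sum only by the newly exceptional strings `d`. For
these, `gain` gives `r + 1 + μ m ≤ μ (d + m p^(r + 1))`, and the induction hypothesis turns this
into divisibility. -/
theorem regularSum_sub (h : DworkHypotheses p Bad A μ) {a u : ℕ}
    (ih : ∀ K m, PDvd p ((u : ℤ) + 1 + μ m) (dworkSum p A a K u m)) (K r m : ℕ) :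
    PDvd p ((r : ℤ) + u + 2 + μ m)
      (regularSum p Bad A a K r (u + 1) m - regularSum p Bad A a K (r + 1) u m) := by
  classical
  have h1 : regularSum p Bad A a K r (u + 1) m = ∑ d ∈ Finset.range (p ^ (r + 1)),
      if RegularDigits p Bad r (d / p) then dworkSum p A a K u (d + m * p ^ (r + 1)) else 0 := by
    rw [pow_succ, sum_range_mul_eq]
    refine Finset.sum_congr rfl fun c _ => ?_
    split_ifs with hc
    · rw [dworkSum_succ]
      refine Finset.sum_congr rfl fun b hb => ?_
      rw [digit_div (Finset.mem_range.1 hb), if_pos hc]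
      congr 1; ring
    · symm
      refine Finset.sum_eq_zero fun b hb => ?_
      rw [digit_div (Finset.mem_range.1 hb), if_neg hc]
  rw [h1, regularSum, ← Finset.sum_sub_distrib]
  refine PDvd.sum fun d hd => ?_
  by_cases hr : RegularDigits p Bad r (d / p)
  · by_cases hb : Bad (r + 1) d
    · rw [if_pos hr, if_neg (by simp [RegularDigits, hb]), sub_zero]
      have := h.gain _ _ m (Finset.mem_range.1 hd) hb
      exact (ih K _).mono (by omega)
    · rw [if_pos hr, if_pos ⟨hr, hb⟩, sub_self]
      exact PDvd.zero _
  · rw [if_neg hr, if_neg (by simp [RegularDigits, hr]), sub_self]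
    exact PDvd.zero _

/-- Exceptional strings are discarded as in `regularSum_sub`. For a regular string `d`, the ratio at
`d / p` is exchanged for the ratio at `d`; the loss `μ d` in `congr_ratio` is repaid by the factor
`dworkSum p A a K u d`. -/
theorem splitSum_sub (h : DworkHypotheses p Bad A μ) {a u : ℕ}
    (ih : ∀ K m, PDvd p ((u : ℤ) + 1 + μ m) (dworkSum p A a K u m)) (K r m : ℕ) :
    PDvd p ((r : ℤ) + u + 2 + μ m)
      (splitSum p Bad A a K r (u + 1) m - splitSum p Bad A a K (r + 1) u m) := by
  classical
  have h1 : splitSum p Bad A a K r (u + 1) m = ∑ d ∈ Finset.range (p ^ (r + 1)),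
      if RegularDigits p Bad r (d / p) then
        A (d / p + m * p ^ r) / A (d / p) * dworkSum p A a K u d else 0 := by
    rw [pow_succ, sum_range_mul_eq]
    refine Finset.sum_congr rfl fun c _ => ?_
    split_ifs with hc
    · rw [dworkSum_succ, Finset.mul_sum]
      refine Finset.sum_congr rfl fun b hb => ?_
      rw [digit_div (Finset.mem_range.1 hb), if_pos hc]
    · symm
      refine Finset.sum_eq_zero fun b hb => ?_
      rw [digit_div (Finset.mem_range.1 hb), if_neg hc]
  rw [h1, splitSum, ← Finset.sum_sub_distrib]
  refine PDvd.sum fun d hd => ?_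
  have hd' := Finset.mem_range.1 hd
  have hdp : d / p < p ^ r := Nat.div_lt_of_lt_mul (by rwa [pow_succ'] at hd')
  by_cases hr : RegularDigits p Bad r (d / p)
  · by_cases hb : Bad (r + 1) d
    · rw [if_pos hr, if_neg (by simp [RegularDigits, hb]), sub_zero]
      have := h.gain _ _ 0 hd' hb
      rw [zero_mul, add_zero] at this
      exact ((h.dvd_ratio r _ m hdp hr).mul (ih K d)).mono (by omega)
    · rw [if_pos hr, if_pos ⟨hr, hb⟩, ← sub_mul]
      have := ((h.congr_ratio r d m hd' ⟨hr, hb⟩).mul (ih K d)).neg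
      rw [← neg_mul, neg_sub] at this
      exact this.mono (by push_cast; omega)
  · rw [if_neg hr, if_neg (by simp [RegularDigits, hr]), sub_self]
    exact PDvd.zero _

/-- Once all `s` lower digits are split off, the two sums can be compared term by term. -/
theorem regularSum_sub_splitSum (h : DworkHypotheses p Bad A μ) {a : ℕ} (ha : a < p)
    (K s m : ℕ) :
    PDvd p ((s : ℤ) + 1 + μ m)
      (regularSum p Bad A a (K + m * p ^ s) s 0 m - splitSum p Bad A a K s 0 m) := by
  classical
  rw [regularSum, splitSum, ← Finset.sum_sub_distrib]
  refine PDvd.sum fun j hj => ?_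
  have hj' := Finset.mem_range.1 hj
  split_ifs with hr
  swap
  · rw [sub_self]; exact PDvd.zero _
  rw [dworkSum_zero, dworkSum_zero, dworkTerm, dworkTerm]
  by_cases hK : j ≤ K
  swap
  · rw [if_neg (by omega), if_neg hK, mul_zero, sub_zero]; exact PDvd.zero _
  rw [if_pos (by omega), if_pos hK, show K + m * p ^ s - (j + m * p ^ s) = K - j by omega]
  have hA := h.ne_zero j
  set n := a + j * p with hn
  have hnp : n / p = j := digit_div ha
  have hn1 : a + (j + m * p ^ s) * p = n + m * p ^ (s + 1) := by rw [hn]; ring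
  have hlt : n < p ^ (s + 1) := by
    have : (j + 1) * p ≤ p ^ s * p := Nat.mul_le_mul_right p hj'
    rw [pow_succ]; rw [add_mul] at this; omega
  -- The products containing `A (a + (K - j) p)` cancel, leaving exactly the quantity that
  -- `congr_ratio` controls, multiplied by `A n`.
  rw [hn1, show A (n + m * p ^ (s + 1)) * A (K - j) - A (j + m * p ^ s) * A (a + (K - j) * p) -
      A (j + m * p ^ s) / A j * (A n * A (K - j) - A j * A (a + (K - j) * p)) =
      (A (n + m * p ^ (s + 1)) - A (j + m * p ^ s) / A j * A n) * A (K - j) by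
    field_simp; ring]
  refine PDvd.mul_right ?_ (h.integral _)
  by_cases hb : Bad (s + 1) n
  · refine PDvd.sub ?_ ?_
    · have := h.gain _ _ m hlt hb
      exact (h.dvd _).mono (by omega)
    · have := h.gain _ _ 0 hlt hb
      rw [zero_mul, add_zero] at this
      exact ((h.dvd_ratio s j m hj' hr).mul (h.dvd n)).mono (by omega)
  · have h1 := (h.congr_ratio s n m hlt ⟨by rwa [hnp], hb⟩).mul (h.dvd n)
    rw [hnp, sub_mul, div_mul_cancel₀ _ (h.ne_zero n)] at h1
    exact h1.mono (by push_cast; omega)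

/-- **Dwork's formal congruences** with exceptional strings of digits. -/
theorem dworkSum_dvd (h : DworkHypotheses p Bad A μ) {a : ℕ} (ha : a < p) (s : ℕ) :
    ∀ K m, PDvd p ((s : ℤ) + 1 + μ m) (dworkSum p A a K s m) := by
  induction s using Nat.strong_induction_on with
  | _ s ih =>
  -- Digits are peeled off one at a time; each step uses the formal congruence at the strictly
  -- smaller level `s - (r + 1)`.
  have hreg : ∀ K m r, r ≤ s → PDvd p ((s : ℤ) + 1 + μ m)
      (dworkSum p A a K s m - regularSum p Bad A a K r (s - r) m) := by
    intro K m r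
    induction r with
    | zero => intro _; rw [Nat.sub_zero, regularSum_zero, sub_self]; exact PDvd.zero _
    | succ r ihr =>
      intro hr
      have h1 := ihr (by omega)
      have h2 := h.regularSum_sub (ih (s - (r + 1)) (by omega)) K r m
      rw [show s - (r + 1) + 1 = s - r by omega] at h2
      have := h1.add (h2.mono (by omega))
      rwa [sub_add_sub_cancel] at this
  have hsplit : ∀ K m r, r ≤ s → PDvd p ((s : ℤ) + 1 + μ m)
      (A m * dworkSum p A a K s 0 - splitSum p Bad A a K r (s - r) m) := by
    intro K m r
    induction r with
    | zero => intro _; rw [Nat.sub_zero, h.splitSum_zero, sub_self]; exact PDvd.zero _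
    | succ r ihr =>
      intro hr
      have h1 := ihr (by omega)
      have h2 := h.splitSum_sub (ih (s - (r + 1)) (by omega)) K r m
      rw [show s - (r + 1) + 1 = s - r by omega] at h2
      have := h1.add (h2.mono (by omega))
      rwa [sub_add_sub_cancel] at this
  -- The leading part `m` factors out as `A m`, so everything reduces to the block `m = 0`.
  have key : ∀ K m, PDvd p ((s : ℤ) + 1 + μ m)
      (dworkSum p A a (K + m * p ^ s) s m - A m * dworkSum p A a K s 0) := by
    intro K m
    have h1 := hreg (K + m * p ^ s) m s le_rfl
    have h2 := hsplit K m s le_rfl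
    rw [Nat.sub_self] at h1 h2
    have := (h1.add (h.regularSum_sub_splitSum ha K s m)).sub h2
    rwa [sub_add_sub_cancel, sub_sub_sub_cancel_right] at this
  -- The blocks add up to zero by antisymmetry. Each block with `m ≥ 1` reduces through `key` to a
  -- zeroth block for a smaller `K`, whence the induction on `K`.
  have hzero : ∀ K, PDvd p ((s : ℤ) + 1) (dworkSum p A a K s 0) := by
    intro K
    induction K using Nat.strong_induction_on with
    | _ K ihK =>
    have h0 := sum_dworkSum_eq_zero (p := p) (A := A) (a := a) hp.out.pos K s
    rw [Finset.sum_range_succ', add_comm] at h0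
    rw [eq_neg_of_add_eq_zero_left h0]
    refine PDvd.neg (PDvd.sum fun m _ => ?_)
    by_cases hK : K < (m + 1) * p ^ s
    · rw [dworkSum_eq_zero_of_lt hK]; exact PDvd.zero _
    · have hpos : 0 < (m + 1) * p ^ s := Nat.mul_pos (by omega) (pow_pos hp.out.pos s)
      have h1 := key (K - (m + 1) * p ^ s) (m + 1)
      rw [Nat.sub_add_cancel (by omega)] at h1
      have h2 := (ihK (K - (m + 1) * p ^ s) (by omega)).mul_left (h.integral (m + 1))
      have := (h1.mono (by omega)).add h2
      rwa [sub_add_cancel] at this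
  intro K m
  by_cases hK : K < m * p ^ s
  · rw [dworkSum_eq_zero_of_lt hK]; exact PDvd.zero _
  · have h1 := key (K - m * p ^ s) m
    rw [Nat.sub_add_cancel (by omega)] at h1
    have := h1.add (((h.dvd m).mul (hzero (K - m * p ^ s))).mono (by omega))
    rwa [sub_add_cancel] at this

end DworkHypotheses

/-! ### The Landau function at rational points. -/

section Landau

variable {q₁ q₂ : ℕ} {e : Fin q₁ → ℕ} {f : Fin q₂ → ℕ}

theorem le_maxTerm_left (e : Fin q₁ → ℕ) (f : Fin q₂ → ℕ) (i : Fin q₁) : e i ≤ maxTerm e f :=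
  le_max_of_le_left (Finset.le_sup (f := e) (Finset.mem_univ i))

theorem le_maxTerm_right (e : Fin q₁ → ℕ) (f : Fin q₂ → ℕ) (j : Fin q₂) : f j ≤ maxTerm e f :=
  le_max_of_le_right (Finset.le_sup (f := f) (Finset.mem_univ j))

/-- The value of the Landau function at the rational number `n / q`. -/
def landauNat (e : Fin q₁ → ℕ) (f : Fin q₂ → ℕ) (n q : ℕ) : ℤ :=
  (∑ i, ((e i * n / q : ℕ) : ℤ)) - ∑ j, ((f j * n / q : ℕ) : ℤ)

theorem landau_natCast_div (e : Fin q₁ → ℕ) (f : Fin q₂ → ℕ) (n q : ℕ) :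
    landau e f ((n : ℝ) / q) = landauNat e f n q := by
  have h : ∀ L : ℕ, ⌊(L : ℝ) * ((n : ℝ) / q)⌋ = ((L * n / q : ℕ) : ℤ) := by
    intro L
    rw [← Nat.floor_div_eq_div (K := ℝ), Int.natCast_floor_eq_floor (by positivity)]
    congr 1; push_cast; ring
  simp only [landau, landauNat, h]

/-- Equality of the two sums makes the contributions of `⌊n / q⌋` cancel. -/
theorem landauNat_mod (hsum : ∑ i, e i = ∑ j, f j) (n : ℕ) {q : ℕ} (hq : 0 < q) :
    landauNat e f n q = landauNat e f (n % q) q := by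
  have h : ∀ L : ℕ, L * n / q = L * (n % q) / q + L * (n / q) := by
    intro L
    conv_lhs => rw [← Nat.mod_add_div n q, mul_add, ← mul_assoc, mul_comm L q, mul_assoc]
    rw [Nat.add_mul_div_left _ _ hq]
  have hs : (∑ i, (e i : ℤ)) = ∑ j, (f j : ℤ) := by exact_mod_cast hsum
  simp only [landauNat, h, Nat.cast_add, Finset.sum_add_distrib, Nat.cast_mul, ← Finset.sum_mul,
    hs]
  ring

theorem landauNat_eq_zero {n q : ℕ} (h : maxTerm e f * n < q) : landauNat e f n q = 0 := by
  have h1 : ∀ i, e i * n / q = 0 := fun i => Nat.div_eq_of_lt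
    (lt_of_le_of_lt (Nat.mul_le_mul_right n (le_maxTerm_left e f i)) h)
  have h2 : ∀ j, f j * n / q = 0 := fun j => Nat.div_eq_of_lt
    (lt_of_le_of_lt (Nat.mul_le_mul_right n (le_maxTerm_right e f j)) h)
  simp [landauNat, h1, h2]

/-- The indicator function of the set where the Landau function is assumed to be positive. -/
def landauInd (M n q : ℕ) : ℕ := if q ≤ M * (n % q) then 1 else 0

theorem landauInd_le (hsum : ∑ i, e i = ∑ j, f j)
    (hlandau : ∀ x : ℝ, 1 / (maxTerm e f : ℝ) ≤ x → x < 1 → 1 ≤ landau e f x)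
    (n : ℕ) {q : ℕ} (hq : 0 < q) :
    (landauInd (maxTerm e f) n q : ℤ) ≤ landauNat e f n q := by
  rw [landauNat_mod hsum n hq, landauInd]
  split_ifs with h
  · rw [← landau_natCast_div]
    have hq' : (0 : ℝ) < q := by exact_mod_cast hq
    have hM : 0 < maxTerm e f := Nat.pos_of_ne_zero fun h0 => by rw [h0] at h; omega
    have hM' : (0 : ℝ) < maxTerm e f := by exact_mod_cast hM
    apply hlandau
    · rw [div_le_div_iff₀ hM' hq', one_mul, mul_comm]
      exact_mod_cast h
    · rw [div_lt_one hq']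
      exact_mod_cast Nat.mod_lt n hq
  · rw [landauNat_eq_zero (by omega)]; simp

end Landau

/-! ### Fractional parts of `n / p ^ l` and base `p` digits. -/

section Digits

variable (p M : ℕ)

/-- The number of `l ≥ 1` for which the fractional part of `n / p ^ l` is at least `1 / M`. -/
def excCount (n : ℕ) : ℕ := ∑ i ∈ Finset.range (M * n), landauInd M n (p ^ (i + 1))

/-- All the fractional parts of `n / p ^ l` for `1 ≤ l ≤ t` are at least `1 / M`. -/
def Exceptional (t n : ℕ) : Prop := ∀ l, 1 ≤ l → l ≤ t → p ^ l ≤ M * (n % p ^ l)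

variable {p M}

theorem Exceptional.mono {s t n : ℕ} (h : Exceptional p M t n) (hs : s ≤ t) :
    Exceptional p M s n :=
  fun l h1 h2 => h l h1 (h2.trans hs)

theorem landauInd_add_mul_pow_of_le (n m : ℕ) {l t : ℕ} (h : l ≤ t) :
    landauInd M (n + m * p ^ t) (p ^ l) = landauInd M n (p ^ l) := by
  obtain ⟨d, rfl⟩ := Nat.exists_eq_add_of_le h
  rw [landauInd, landauInd, pow_add, mul_left_comm, Nat.add_mul_mod_self_left]

variable [hp : Fact p.Prime]

/-- Levels with `p^(i + 1) > M n` contribute nothing, so any large enough cutoff may be used; this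
lets several counts share one range. -/
theorem excCount_eq {n b : ℕ} (h : M * n ≤ b) :
    excCount p M n = ∑ i ∈ Finset.range b, landauInd M n (p ^ (i + 1)) := by
  refine Finset.sum_subset (Finset.range_mono h) fun i _ hi => ?_
  have h1 : M * n ≤ i := by simpa using hi
  have h2 : i + 1 < p ^ (i + 1) := Nat.lt_pow_self hp.out.one_lt
  have h3 : M * (n % p ^ (i + 1)) ≤ M * n := Nat.mul_le_mul_left _ (Nat.mod_le _ _)
  rw [landauInd, if_neg (by omega)]

theorem Exceptional.le_excCount {t n : ℕ} (h : Exceptional p M t n) : t ≤ excCount p M n := by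
  rw [excCount_eq (b := M * n + t) (by omega), add_comm (M * n), Finset.sum_range_add]
  refine le_trans ?_ (Nat.le_add_right _ _)
  rw [Finset.sum_congr rfl (g := fun _ => 1)]
  · simp
  · intro i hi
    rw [landauInd, if_pos (h _ (by omega) (by simpa using hi))]

/-- Appending `t` low digits to `m` and dividing by `p^t` can only increase each fractional part. -/
theorem landauInd_le_shift {n t : ℕ} (hn : n < p ^ t) (m l : ℕ) :
    landauInd M m (p ^ l) ≤ landauInd M (n + m * p ^ t) (p ^ (t + l)) := by
  have hpos := pow_pos hp.out.pos t
  unfold landauInd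
  split_ifs with h1 h2 <;> try omega
  refine absurd ?_ h2
  rw [pow_add, Nat.mod_mul, Nat.add_mul_div_right _ _ hpos, Nat.div_eq_of_lt hn, zero_add]
  calc p ^ t * p ^ l ≤ p ^ t * (M * (m % p ^ l)) := Nat.mul_le_mul_left _ h1
    _ = M * (p ^ t * (m % p ^ l)) := by ring
    _ ≤ _ := Nat.mul_le_mul_left _ (Nat.le_add_left _ _)

theorem Exceptional.add_excCount_le {t n : ℕ} (m : ℕ) (hn : n < p ^ t)
    (h : Exceptional p M t n) : t + excCount p M m ≤ excCount p M (n + m * p ^ t) := by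
  obtain ⟨b, hb₁, hb₂⟩ : ∃ b, M * (n + m * p ^ t) ≤ b ∧ M * m ≤ b :=
    ⟨_, le_max_left _ _, le_max_right _ _⟩
  rw [excCount_eq (n := m) (b := b) (by omega),
    excCount_eq (n := n + m * p ^ t) (b := t + b) (by omega), Finset.sum_range_add]
  refine Nat.add_le_add ?_ (Finset.sum_le_sum fun i _ => ?_)
  · rw [Finset.sum_congr rfl (g := fun _ => 1)]
    · simp
    · intro i hi
      have hi' : i + 1 ≤ t := by simpa using hi
      rw [landauInd_add_mul_pow_of_le n m hi', landauInd, if_pos (h _ (by omega) hi')]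
  · rw [add_assoc]; exact landauInd_le_shift hn m _

/-- The leading segment ending at the first nonzero digit of `u` has length `s - d` and value at
least `1`. As `p^(s - d) < M`, all its fractional parts are at least `1 / M`, so it is exceptional.
-/
theorem not_regularDigits {s : ℕ} : ∀ {u d : ℕ}, d < s → p ^ d ≤ u → u < p ^ (d + 1) →
    p ^ (s - d) < M → ¬ RegularDigits p (Exceptional p M) s u := by
  induction s with
  | zero => intro u d h; omega
  | succ s ih =>
    intro u d hd h1 h2 h3 ⟨hr, hb⟩
    rcases Nat.eq_zero_or_pos d with rfl | hd0
    · refine hb fun l hl hls => ?_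
      have hul : u < p ^ l := lt_of_lt_of_le h2 (Nat.pow_le_pow_right hp.out.pos (by omega))
      rw [Nat.mod_eq_of_lt hul]
      rw [pow_zero] at h1
      rw [Nat.sub_zero] at h3
      calc p ^ l ≤ p ^ (s + 1) := Nat.pow_le_pow_right hp.out.pos hls
        _ ≤ M * 1 := by omega
        _ ≤ M * u := Nat.mul_le_mul_left _ h1
    · obtain ⟨d, rfl⟩ : ∃ c, d = c + 1 := ⟨d - 1, by omega⟩
      refine ih (u := u / p) (d := d) (by omega) ?_ ?_ (by rwa [Nat.add_sub_add_right] at h3) hr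
      · rw [Nat.le_div_iff_mul_le hp.out.pos]; rwa [pow_succ] at h1
      · refine Nat.div_lt_of_lt_mul ?_; rwa [pow_succ'] at h2

/-- Regularity thus forces enough leading zeros for all Landau terms of `u` beyond level `s` to
vanish. -/
theorem RegularDigits.mul_lt {s u : ℕ} (hu : u < p ^ s)
    (h : RegularDigits p (Exceptional p M) s u) : M * u < p ^ (s + 1) := by
  by_contra hc
  rw [not_lt] at hc
  have hu0 : u ≠ 0 := by
    rintro rfl
    have := pow_pos hp.out.pos (s + 1)
    omega
  have h1 := Nat.pow_log_le_self p hu0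
  have h2 := Nat.lt_pow_succ_log_self hp.out.one_lt u
  have hd : Nat.log p u < s := (Nat.pow_lt_pow_iff_right hp.out.one_lt).1 (h1.trans_lt hu)
  refine not_regularDigits hd h1 h2 ?_ h
  have hM : 0 < M := Nat.pos_of_ne_zero fun h0 => by
    have := pow_pos hp.out.pos (s + 1)
    rw [h0] at hc; omega
  have h3 : p ^ (s - Nat.log p u) * p ^ (Nat.log p u + 1) < M * p ^ (Nat.log p u + 1) := by
    rw [← pow_add, show s - Nat.log p u + (Nat.log p u + 1) = s + 1 by omega]
    exact hc.trans_lt ((Nat.mul_lt_mul_left hM).2 h2)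
  exact lt_of_mul_lt_mul_right h3 (Nat.zero_le _)

/-- A multiple of `p ^ k` between `L p ⌊n / p⌋` and `L n` forces large fractional parts. -/
theorem exceptional_of_pow_dvd {L n k lam x : ℕ} (hL : p ^ lam * L ≤ M)
    (h1 : L * (p * (n / p)) < x) (h2 : x ≤ L * n) (hx : p ^ k ∣ x) :
    Exceptional p M (k + lam) n := by
  intro l hl hlk
  have hLM : L ≤ M := le_trans (Nat.le_mul_of_pos_left L (pow_pos hp.out.pos lam)) hL
  have hc : p ^ l * (n / p ^ l) ≤ p * (n / p) := by
    obtain ⟨l, rfl⟩ : ∃ c, l = c + 1 := ⟨l - 1, by omega⟩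
    rw [pow_succ', ← Nat.div_div_eq_div_mul, mul_assoc]
    exact Nat.mul_le_mul_left _ (Nat.mul_div_le _ _)
  -- Subtracting `L p^l ⌊n / p^l⌋` from `x` leaves a positive integer at most `L (n mod p^l)`. It is
  -- divisible by `p^l` if `l ≤ k`. Otherwise it is divisible only by `p^k`, and the factor `p^lam`
  -- in `hL` makes up for the difference.
  have h3 : L * (p ^ l * (n / p ^ l)) < x := (Nat.mul_le_mul_left L hc).trans_lt h1
  have h4 : x - L * (p ^ l * (n / p ^ l)) ≤ L * (n % p ^ l) := by
    conv at h2 => rw [← Nat.mod_add_div n (p ^ l), mul_add]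
    omega
  rcases le_or_gt l k with hlk' | hlk'
  · have hdvd : p ^ l ∣ x - L * (p ^ l * (n / p ^ l)) :=
      Nat.dvd_sub ((pow_dvd_pow p hlk').trans hx)
        (Dvd.intro (L * (n / p ^ l)) (by ring))
    exact (Nat.le_of_dvd (by omega) hdvd).trans (h4.trans (Nat.mul_le_mul_right _ hLM))
  · have hdvd : p ^ k ∣ x - L * (p ^ l * (n / p ^ l)) :=
      Nat.dvd_sub hx (Dvd.dvd.mul_left (Dvd.dvd.mul_right (pow_dvd_pow p hlk'.le) _) _)
    have h5 := (Nat.le_of_dvd (by omega) hdvd).trans h4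
    calc p ^ l ≤ p ^ (lam + k) := Nat.pow_le_pow_right hp.out.pos (by omega)
      _ = p ^ lam * p ^ k := pow_add _ _ _
      _ ≤ p ^ lam * (L * (n % p ^ l)) := Nat.mul_le_mul_left _ h5
      _ = p ^ lam * L * (n % p ^ l) := by ring
      _ ≤ _ := Nat.mul_le_mul_right _ hL

theorem excCount_mul_prime (n : ℕ) : excCount p M n ≤ excCount p M (n * p) := by
  obtain ⟨b, hb₁, hb₂⟩ : ∃ b, M * (n * p) ≤ b ∧ M * n ≤ b :=
    ⟨_, le_max_left _ _, le_max_right _ _⟩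
  rw [excCount_eq (n := n) (b := b) hb₂, excCount_eq (n := n * p) (b := 1 + b) (by omega),
    Finset.sum_range_add]
  refine le_trans (Finset.sum_le_sum fun i _ => ?_) (Nat.le_add_left _ _)
  have := landauInd_le_shift (M := M) (p := p) (n := 0) (t := 1) (by simpa using hp.out.pos) n
    (i + 1)
  rw [zero_add, pow_one] at this
  rwa [add_assoc]

/-- Multiplying by `p` does not decrease the count, so `n` may be taken prime to `p`; then
`exceptional_of_pow_dvd` applies to `x = L n` with `k = 0`. -/
theorem le_excCount {L lam : ℕ} (hL0 : 0 < L) (hL : p ^ lam * L ≤ M) (n : ℕ) (hn : n ≠ 0) :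
    lam ≤ excCount p M n := by
  induction n using Nat.strong_induction_on with
  | _ n ih =>
  by_cases hpn : p ∣ n
  · obtain ⟨c, rfl⟩ := hpn
    have hc : c ≠ 0 := by rintro rfl; simp at hn
    rw [mul_comm]
    exact (ih c (lt_mul_of_one_lt_left (Nat.pos_of_ne_zero hc) hp.out.one_lt) hc).trans
      (excCount_mul_prime c)
  · have hlt : p * (n / p) < n := lt_of_le_of_ne (Nat.mul_div_le n p) fun h =>
      hpn ⟨_, h.symm⟩
    have := exceptional_of_pow_dvd (p := p) (M := M) (n := n) (k := 0) (x := L * n) hL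
      ((Nat.mul_lt_mul_left hL0).2 hlt) le_rfl (by simp)
    rw [zero_add] at this
    exact this.le_excCount

end Digits

/-! ### Valuations of the factorial ratios. -/

section Valuation

variable {q₁ q₂ : ℕ} {e : Fin q₁ → ℕ} {f : Fin q₂ → ℕ} {p : ℕ} [hp : Fact p.Prime]

theorem factorialRatio_ne_zero (e : Fin q₁ → ℕ) (f : Fin q₂ → ℕ) (n : ℕ) :
    factorialRatio e f n ≠ 0 :=
  div_ne_zero (Finset.prod_ne_zero_iff.2 fun i _ => by exact_mod_cast Nat.factorial_ne_zero _)
    (Finset.prod_ne_zero_iff.2 fun i _ => by exact_mod_cast Nat.factorial_ne_zero _)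

theorem padicValRat_prod {ι : Type*} (s : Finset ι) (F : ι → ℚ) (hF : ∀ i ∈ s, F i ≠ 0) :
    padicValRat p (∏ i ∈ s, F i) = ∑ i ∈ s, padicValRat p (F i) := by
  classical
  induction s using Finset.induction_on with
  | empty => simp
  | insert a s ha ih =>
    have h := fun i hi => hF i (Finset.mem_insert_of_mem hi)
    rw [Finset.prod_insert ha, Finset.sum_insert ha,
      padicValRat.mul (hF a (by simp)) (Finset.prod_ne_zero_iff.2 h), ih h]

theorem padicValRat_factorial {N b : ℕ} (h : N ≤ b) :
    padicValRat p (N.factorial : ℚ) =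
      ∑ i ∈ Finset.range b, ((N / p ^ (i + 1) : ℕ) : ℤ) := by
  rw [padicValRat.of_nat, padicValNat_factorial (b := b + 1)
    ((Nat.log_le_self p N).trans_lt (by omega)), Finset.sum_Ico_eq_sum_range]
  simp [add_comm]

theorem padicValRat_factorialRatio {n b : ℕ} (h : maxTerm e f * n ≤ b) :
    padicValRat p (factorialRatio e f n) =
      ∑ i ∈ Finset.range b, landauNat e f n (p ^ (i + 1)) := by
  have hne : ∀ N : ℕ, (N.factorial : ℚ) ≠ 0 := fun N => by exact_mod_cast Nat.factorial_ne_zero _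
  rw [factorialRatio, padicValRat.div (Finset.prod_ne_zero_iff.2 fun i _ => hne _)
    (Finset.prod_ne_zero_iff.2 fun i _ => hne _), padicValRat_prod _ _ fun i _ => hne _,
    padicValRat_prod _ _ fun i _ => hne _]
  simp only [landauNat, Finset.sum_sub_distrib]
  congr 1
  · rw [Finset.sum_comm]
    exact Finset.sum_congr rfl fun i _ => padicValRat_factorial
      ((Nat.mul_le_mul_right n (le_maxTerm_left e f i)).trans h)
  · rw [Finset.sum_comm]
    exact Finset.sum_congr rfl fun i _ => padicValRat_factorial
      ((Nat.mul_le_mul_right n (le_maxTerm_right e f i)).trans h)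

theorem factorialRatio_dvd (hsum : ∑ i, e i = ∑ j, f j)
    (hlandau : ∀ x : ℝ, 1 / (maxTerm e f : ℝ) ≤ x → x < 1 → 1 ≤ landau e f x) (n : ℕ) :
    PDvd p (excCount p (maxTerm e f) n) (factorialRatio e f n) := by
  refine PDvd.of_le_padicValRat fun _ => ?_
  rw [padicValRat_factorialRatio le_rfl, excCount, Nat.cast_sum]
  exact Finset.sum_le_sum fun i _ => landauInd_le hsum hlandau n (pow_pos hp.out.pos _)

/-- By periodicity the levels up to `s` cancel. Beyond `s` the terms of `u` vanish by
`RegularDigits.mul_lt`, and those of `u + m p^s` dominate the indicators of `m`. -/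
theorem factorialRatio_div_dvd (hsum : ∑ i, e i = ∑ j, f j)
    (hlandau : ∀ x : ℝ, 1 / (maxTerm e f : ℝ) ≤ x → x < 1 → 1 ≤ landau e f x) {s u : ℕ}
    (m : ℕ) (hu : u < p ^ s) (hr : RegularDigits p (Exceptional p (maxTerm e f)) s u) :
    PDvd p (excCount p (maxTerm e f) m)
      (factorialRatio e f (u + m * p ^ s) / factorialRatio e f u) := by
  refine PDvd.of_le_padicValRat fun _ => ?_
  obtain ⟨b, hb⟩ : ∃ b, b = maxTerm e f * (u + m * p ^ s) + maxTerm e f * u + maxTerm e f * m :=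
    ⟨_, rfl⟩
  rw [padicValRat.div (factorialRatio_ne_zero _ _ _) (factorialRatio_ne_zero _ _ _),
    padicValRat_factorialRatio (b := s + b) (by omega),
    padicValRat_factorialRatio (b := s + b) (by omega), excCount_eq (b := b) (by omega),
    ← Finset.sum_sub_distrib, Finset.sum_range_add, Nat.cast_sum]
  have h0 : ∑ i ∈ Finset.range s, (landauNat e f (u + m * p ^ s) (p ^ (i + 1)) -
      landauNat e f u (p ^ (i + 1))) = 0 := by
    refine Finset.sum_eq_zero fun i hi => ?_
    have hi' : i + 1 ≤ s := by simpa using hi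
    obtain ⟨d, hd⟩ := Nat.exists_eq_add_of_le hi'
    have hpos := pow_pos hp.out.pos (i + 1)
    rw [landauNat_mod hsum _ hpos, landauNat_mod hsum u hpos, hd, pow_add _ (i + 1),
      mul_left_comm, Nat.add_mul_mod_self_left, sub_self]
  rw [h0, zero_add]
  refine Finset.sum_le_sum fun i _ => ?_
  have hz : landauNat e f u (p ^ (s + i + 1)) = 0 := landauNat_eq_zero
    ((hr.mul_lt hu).trans_le (Nat.pow_le_pow_right hp.out.pos (by omega)))
  rw [hz, sub_zero]
  refine le_trans ?_ (landauInd_le hsum hlandau _ (pow_pos hp.out.pos _))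
  rw [add_assoc]
  exact_mod_cast landauInd_le_shift hu m (i + 1)

end Valuation

/-! ### Factorials and their ratios modulo prime powers. -/

section UnitFactorial

/-- The product of the integers from `1` to `N` that are prime to `p`. -/
def unitFactorial (p N : ℕ) : ℕ := ∏ i ∈ Finset.range N, if p ∣ i + 1 then 1 else i + 1

theorem unitFactorial_succ (p N : ℕ) :
    unitFactorial p (N + 1) = unitFactorial p N * if p ∣ N + 1 then 1 else N + 1 :=
  Finset.prod_range_succ _ _

theorem factorial_eq_unitFactorial (p N : ℕ) :
    N.factorial = unitFactorial p N * p ^ (N / p) * (N / p).factorial := by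
  induction N with
  | zero => simp [unitFactorial]
  | succ N ih =>
    rw [Nat.factorial_succ, ih, unitFactorial_succ, Nat.succ_div]
    split_ifs with h
    · have h1 : N + 1 = p * (N / p + 1) := by
        rw [← Nat.succ_div_of_dvd h, Nat.mul_div_cancel' h]
      rw [Nat.factorial_succ, pow_succ]
      conv_lhs => rw [h1]
      ring
    · rw [add_zero]; ring

theorem not_dvd_unitFactorial {p : ℕ} (hp : p.Prime) (N : ℕ) : ¬ p ∣ unitFactorial p N := by
  intro h
  obtain ⟨i, _, hi⟩ := (hp.prime.dvd_finsetProd_iff _).1 h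
  split_ifs at hi with h1
  · exact hp.one_lt.ne' (Nat.dvd_one.1 hi)
  · exact h1 hi

/-- A shift by `p^(s + 1)` preserves both residues and divisibility by `p`, so the extra factors
match one by one. -/
theorem unitFactorial_add (p s a : ℕ) :
    unitFactorial p (a + p ^ (s + 1)) ≡
      unitFactorial p a * unitFactorial p (p ^ (s + 1)) [MOD p ^ (s + 1)] := by
  induction a with
  | zero => simp [unitFactorial, Nat.ModEq.refl]
  | succ a ih =>
    have h1 : a + p ^ (s + 1) + 1 ≡ a + 1 [MOD p ^ (s + 1)] := by
      rw [add_right_comm]; simp [Nat.ModEq]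
    have h2 : p ∣ a + p ^ (s + 1) + 1 ↔ p ∣ a + 1 := by
      rw [add_right_comm]
      exact (Nat.dvd_add_left (dvd_pow_self p (by omega)))
    rw [add_right_comm, unitFactorial_succ, unitFactorial_succ, mul_right_comm]
    refine ih.mul ?_
    by_cases h : p ∣ a + 1
    · rw [if_pos h, if_pos (h2.2 h)]
    · rwa [if_neg h, if_neg (fun h' => h (h2.1 h'))]

theorem unitFactorial_add_mul (p s a t : ℕ) :
    unitFactorial p (a + p ^ (s + 1) * t) ≡
      unitFactorial p a * unitFactorial p (p ^ (s + 1)) ^ t [MOD p ^ (s + 1)] := by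
  induction t with
  | zero => simp [Nat.ModEq.refl]
  | succ t ih =>
    rw [Nat.mul_succ, ← add_assoc, pow_succ (unitFactorial p _), ← mul_assoc]
    exact (unitFactorial_add p s _).trans (ih.mul_right _)

/-- This form isolates the integers of `(a, a + c]`, whose divisibility by `p` governs the distance
of the product from `1`. -/
theorem factorial_add_div {a c D : ℕ} :
    ((a + c + D).factorial : ℚ) / (a + c).factorial =
      (∏ i ∈ Finset.range c, (1 + (D : ℚ) * ((a + 1 + i : ℕ) : ℚ)⁻¹)) *
        (((a + D).factorial : ℚ) / a.factorial) := by
  have h : ∀ b : ℕ, ((b + c).factorial : ℚ) =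
      b.factorial * ∏ i ∈ Finset.range c, ((b + 1 + i : ℕ) : ℚ) := by
    intro b
    rw [← Nat.factorial_mul_ascFactorial, Nat.ascFactorial_eq_prod_range]
    push_cast; rfl
  have hne : ∀ i ∈ Finset.range c, ((a + 1 + i : ℕ) : ℚ) ≠ 0 := fun i _ => by
    exact_mod_cast (by omega : a + 1 + i ≠ 0)
  have h1 : ∏ i ∈ Finset.range c, ((a + 1 + i : ℕ) : ℚ) ≠ 0 := Finset.prod_ne_zero_iff.2 hne
  have h2 : (∏ i ∈ Finset.range c, (1 + (D : ℚ) * ((a + 1 + i : ℕ) : ℚ)⁻¹)) =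
      (∏ i ∈ Finset.range c, ((a + D + 1 + i : ℕ) : ℚ)) /
        ∏ i ∈ Finset.range c, ((a + 1 + i : ℕ) : ℚ) := by
    rw [← Finset.prod_div_distrib]
    refine Finset.prod_congr rfl fun i hi => ?_
    rw [eq_div_iff (hne i hi), add_mul, mul_assoc, inv_mul_cancel₀ (hne i hi)]
    push_cast; ring
  have h3 : (a.factorial : ℚ) ≠ 0 := by exact_mod_cast Nat.factorial_ne_zero a
  rw [h2, show a + c + D = a + D + c by ring, h (a + D), h a]
  field_simp

end UnitFactorial

theorem padicNorm_eq_one_of_sub {p : ℕ} [hp : Fact p.Prime] {x u : ℚ} {k : ℤ} (hk : 1 ≤ k)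
    (h : PDvd p k (x - u)) (hu : padicNorm p u = 1) : padicNorm p x = 1 := by
  have h1 : padicNorm p (x - u) < 1 := by
    refine lt_of_le_of_lt (h.mono hk) ?_
    have : (1 : ℚ) < p := by exact_mod_cast hp.out.one_lt
    rw [zpow_neg, zpow_one]
    exact inv_lt_one_of_one_lt₀ this
  have h2 := padicNorm.add_eq_max_of_ne (p := p) (q := x - u) (r := u) (by rw [hu]; exact h1.ne)
  rwa [sub_add_cancel, hu, max_eq_right h1.le] at h2

section Congruence

variable {p : ℕ} [hp : Fact p.Prime]

/-- The unit by which the quotient `(L (n + m p ^ (s + 1)))! / (L n)!` differs from the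
corresponding quotient for `⌊n / p⌋`, up to a power of `p`. -/
noncomputable def factorialUnit (p L n m s : ℕ) : ℚ :=
  ((unitFactorial p (L * n + p ^ (s + 1) * (L * m)) : ℚ) / unitFactorial p (L * n)) *
    ∏ i ∈ Finset.range (L * n / p - L * (n / p)),
      (1 + ((L * m * p ^ s : ℕ) : ℚ) * ((L * (n / p) + 1 + i : ℕ) : ℚ)⁻¹)

/-- Removing the multiples of `p` from the factorials leads to `⌊L n / p⌋`, which can exceed `L ⌊n /
p⌋`; `factorial_add_div` accounts for the gap. -/
theorem factorial_div_eq_factorialUnit (L n m s : ℕ) :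
    ((L * (n + m * p ^ (s + 1))).factorial : ℚ) / (L * n).factorial =
      factorialUnit p L n m s * (p : ℚ) ^ (L * (m * p ^ s)) *
        (((L * (n / p + m * p ^ s)).factorial : ℚ) / (L * (n / p)).factorial) := by
  have hp0 := hp.out.pos
  have hpq : (p : ℚ) ≠ 0 := by exact_mod_cast hp0.ne'
  have hc : L * (n / p) + (L * n / p - L * (n / p)) = L * n / p := by
    refine Nat.add_sub_of_le ?_
    rw [Nat.le_div_iff_mul_le hp0, mul_assoc]
    exact Nat.mul_le_mul_left L (Nat.div_mul_le_self n p)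
  have h1 : L * (n + m * p ^ (s + 1)) = L * n + p ^ (s + 1) * (L * m) := by ring
  have h2 : (L * n + p ^ (s + 1) * (L * m)) / p = L * n / p + L * m * p ^ s := by
    rw [show p ^ (s + 1) * (L * m) = p * (L * m * p ^ s) by ring, Nat.add_mul_div_left _ _ hp0]
  have h3 := factorial_add_div (a := L * (n / p)) (c := L * n / p - L * (n / p))
    (D := L * m * p ^ s)
  rw [hc] at h3
  have hf : ∀ N : ℕ, (N.factorial : ℚ) ≠ 0 := fun N => by exact_mod_cast Nat.factorial_ne_zero N
  have hu : (unitFactorial p (L * n) : ℚ) ≠ 0 := fun h => by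
    have h' : unitFactorial p (L * n) = 0 := by exact_mod_cast h
    exact not_dvd_unitFactorial hp.out (L * n) (h' ▸ dvd_zero p)
  rw [h1, factorial_eq_unitFactorial p (L * n + _), factorial_eq_unitFactorial p (L * n), h2,
    factorialUnit, show L * (n / p + m * p ^ s) = L * (n / p) + L * m * p ^ s by ring,
    ← mul_assoc L m, show ∀ a b c d : ℚ, a * b * c * d = a * c * (b * d) by intros; ring, ← h3]
  push_cast
  have := hf (L * n / p)
  rw [pow_add _ (L * n / p)]
  field_simp

/-- The part prime to `p` is a power of `unitFactorial p (p ^ (s + 1))` modulo `p^(s + 1)`. Only the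
integers in the gap, of valuation at most `k - 1`, weaken the congruence, because `p^s` is divided
by them. -/
theorem factorialUnit_sub {L n m s : ℕ} {k : ℕ}
    (h : ∀ i t, i < L * n / p - L * (n / p) → p ^ t ∣ L * (n / p) + 1 + i → t + 1 ≤ k)
    (hk : k ≤ s) :
    PDvd p ((s : ℤ) + 1 - k)
      (factorialUnit p L n m s - ((unitFactorial p (p ^ (s + 1)) : ℕ) : ℚ) ^ (L * m)) := by
  set w := unitFactorial p (p ^ (s + 1)) with hw
  have hnorm : padicNorm p (unitFactorial p (L * n) : ℚ) = 1 :=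
    (padicNorm.nat_eq_one_iff _).2 (not_dvd_unitFactorial hp.out _)
  have hu : (unitFactorial p (L * n) : ℚ) ≠ 0 := fun h => by
    rw [h, padicNorm.zero] at hnorm; exact zero_ne_one hnorm
  have h1 : PDvd p ((s : ℤ) + 1) ((unitFactorial p (L * n + p ^ (s + 1) * (L * m)) : ℚ) /
      unitFactorial p (L * n) - (w : ℚ) ^ (L * m)) := by
    have h2 := (unitFactorial_add_mul p s (L * n) (L * m)).symm.dvd
    have h3 := (PDvd.intCast_iff (p := p) (n := s + 1)).2 h2
    rw [show (unitFactorial p (L * n + p ^ (s + 1) * (L * m)) : ℚ) / unitFactorial p (L * n) -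
      (w : ℚ) ^ (L * m) = ((unitFactorial p (L * n + p ^ (s + 1) * (L * m)) : ℚ) -
        unitFactorial p (L * n) * (w : ℚ) ^ (L * m)) / unitFactorial p (L * n) by field_simp]
    refine PDvd.div_of_unit ?_ hnorm
    push_cast at h3
    exact h3
  have h4 : ∀ i ∈ Finset.range (L * n / p - L * (n / p)), PDvd p ((s : ℤ) + 1 - k)
      (((L * m * p ^ s : ℕ) : ℚ) * ((L * (n / p) + 1 + i : ℕ) : ℚ)⁻¹) := by
    intro i hi
    -- Taking `t = 0` shows that a nonempty gap forces `k ≥ 1`, so the natural subtraction `k - 1`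
    -- is not truncated.
    have hk1 : 1 ≤ k := h i 0 (Finset.mem_range.1 hi) (by simp) |> fun h => by omega
    have h5 : PDvd p (-((k - 1 : ℕ) : ℤ)) (((L * (n / p) + 1 + i : ℕ) : ℚ)⁻¹) := by
      refine PDvd.inv_natCast (by omega) fun hd => ?_
      have := h i _ (Finset.mem_range.1 hi) hd
      omega
    have h6 : PDvd p (s : ℤ) ((L * m * p ^ s : ℕ) : ℚ) :=
      PDvd.natCast_of_dvd (Dvd.intro_left _ rfl)
    exact (h6.mul h5).mono (by omega)
  have h7 : PDvd p ((s : ℤ) + 1 - k) ((∏ i ∈ Finset.range (L * n / p - L * (n / p)),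
      (1 + ((L * m * p ^ s : ℕ) : ℚ) * ((L * (n / p) + 1 + i : ℕ) : ℚ)⁻¹)) -
        ∏ i ∈ Finset.range (L * n / p - L * (n / p)), 1) := by
    refine PDvd.prod_sub_prod (fun i hi => PDvd.one.add ((h4 i hi).mono (by omega)))
      (fun i hi => PDvd.one) fun i hi => ?_
    rw [add_sub_cancel_left]; exact h4 i hi
  rw [Finset.prod_const_one] at h7
  have := PDvd.mul_sub_mul (x' := (w : ℚ) ^ (L * m)) (y' := 1) ?_ PDvd.one
    (h1.mono (by omega)) h7
  · rwa [mul_one] at this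
  · exact (PDvd.natCast _).div_of_unit hnorm

theorem factorialRatio_congr {q₁ q₂ : ℕ} {e : Fin q₁ → ℕ} {f : Fin q₂ → ℕ}
    (hsum : ∑ i, e i = ∑ j, f j)
    (hlandau : ∀ x : ℝ, 1 / (maxTerm e f : ℝ) ≤ x → x < 1 → 1 ≤ landau e f x) (s n m : ℕ)
    (hn : n < p ^ (s + 1))
    (hr : RegularDigits p (Exceptional p (maxTerm e f)) (s + 1) n) :
    PDvd p ((s + 1 : ℕ) + excCount p (maxTerm e f) m - excCount p (maxTerm e f) n)
      (factorialRatio e f (n + m * p ^ (s + 1)) / factorialRatio e f n -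
        factorialRatio e f (n / p + m * p ^ s) / factorialRatio e f (n / p)) := by
  set M := maxTerm e f with hM
  have hp0 := hp.out.pos
  -- The loss is bounded by `excCount p M n`. Capping it at `s`, possible because `n` is not
  -- exceptional at level `s + 1`, keeps the exponent `s + 1 - k` positive, so that `Pf` is a
  -- `p`-adic unit.
  obtain ⟨k, hk⟩ : ∃ k, k = min s (excCount p M n) := ⟨_, rfl⟩
  have hks : k ≤ s := by omega
  have hunit : ∀ L, L ≤ M → PDvd p ((s : ℤ) + 1 - k)
      (factorialUnit p L n m s - ((unitFactorial p (p ^ (s + 1)) : ℕ) : ℚ) ^ (L * m)) := by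
    intro L hL
    -- If `p^t` divides an integer `x` of the gap, then `p x` is a multiple of `p^(t + 1)` in `(L p
    -- ⌊n / p⌋, L n]`, so `n` is exceptional at level `t + 1`.
    refine factorialUnit_sub (fun i t hi ht => ?_) hks
    have h1 : Exceptional p M (t + 1) n := by
      have := exceptional_of_pow_dvd (p := p) (M := M) (L := L) (n := n) (k := t + 1) (lam := 0)
        (x := p * (L * (n / p) + 1 + i)) (by simpa using hL) ?_ ?_ ?_
      · simpa using this
      · rw [mul_left_comm]
        exact (Nat.mul_lt_mul_left hp0).2 (by omega)
      · calc p * (L * (n / p) + 1 + i) ≤ p * (L * n / p) := Nat.mul_le_mul_left _ (by omega)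
          _ ≤ L * n := Nat.mul_div_le _ _
      · rw [pow_succ']; exact Nat.mul_dvd_mul_left p ht
    have h2 := h1.le_excCount
    have h3 : t + 1 ≤ s := by
      by_contra hc
      exact hr.2 (h1.mono (by omega))
    omega
  set w : ℚ := ((unitFactorial p (p ^ (s + 1)) : ℕ) : ℚ) with hw
  have hwint : ∀ N, PDvd p 0 (w ^ N) := fun N => (PDvd.natCast _).pow N
  have hint : ∀ L, L ≤ M → PDvd p 0 (factorialUnit p L n m s) := fun L hL => by
    have := ((hunit L hL).mono (l := 0) (by omega)).add (hwint (L * m))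
    rwa [sub_add_cancel] at this
  set Pe := ∏ i, factorialUnit p (e i) n m s with hPe
  set Pf := ∏ j, factorialUnit p (f j) n m s with hPf
  have hE : PDvd p ((s : ℤ) + 1 - k) (Pe - ∏ i, w ^ (e i * m)) :=
    PDvd.prod_sub_prod (fun i _ => hint _ (le_maxTerm_left e f i)) (fun i _ => hwint _)
      fun i _ => hunit _ (le_maxTerm_left e f i)
  have hF : PDvd p ((s : ℤ) + 1 - k) (Pf - ∏ j, w ^ (f j * m)) :=
    PDvd.prod_sub_prod (fun i _ => hint _ (le_maxTerm_right e f i)) (fun i _ => hwint _)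
      fun i _ => hunit _ (le_maxTerm_right e f i)
  -- Equality of the sums cancels both the powers of `w` and the powers of `p` between numerator and
  -- denominator.
  have hpw : ∀ (x : ℚ) (N : ℕ), ∏ i, x ^ (e i * N) = ∏ j, x ^ (f j * N) := fun x N => by
    rw [Finset.prod_pow_eq_pow_sum, Finset.prod_pow_eq_pow_sum, ← Finset.sum_mul,
      ← Finset.sum_mul, hsum]
  have hEF : PDvd p ((s : ℤ) + 1 - k) (Pe - Pf) := by
    have := hE.sub hF
    rwa [hpw w m, sub_sub_sub_cancel_right] at this
  have hPf1 : padicNorm p Pf = 1 := by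
    refine padicNorm_eq_one_of_sub (by omega) hF ?_
    rw [Finset.prod_pow_eq_pow_sum]
    have : ¬ p ∣ unitFactorial p (p ^ (s + 1)) ^ (∑ j, f j * m) := fun h =>
      not_dvd_unitFactorial hp.out _ (hp.out.dvd_of_dvd_pow h)
    have := (padicNorm.nat_eq_one_iff (p := p) _).2 this
    push_cast at this
    exact this
  have hPf0 : Pf ≠ 0 := fun h => by
    rw [h, padicNorm.zero] at hPf1; exact zero_ne_one hPf1
  have hquot : ∀ x y : ℕ, factorialRatio e f x / factorialRatio e f y =
      (∏ i, ((e i * x).factorial : ℚ) / (e i * y).factorial) /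
        ∏ j, ((f j * x).factorial : ℚ) / (f j * y).factorial := by
    intro x y
    rw [factorialRatio, factorialRatio, Finset.prod_div_distrib, Finset.prod_div_distrib,
      div_div_div_comm]
  have hpp : ∏ j, (p : ℚ) ^ (f j * (m * p ^ s)) ≠ 0 :=
    Finset.prod_ne_zero_iff.2 fun j _ => pow_ne_zero _ (by exact_mod_cast hp0.ne')
  have hratio : factorialRatio e f (n + m * p ^ (s + 1)) / factorialRatio e f n =
      Pe / Pf * (factorialRatio e f (n / p + m * p ^ s) / factorialRatio e f (n / p)) := by
    rw [hquot, hquot]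
    simp only [factorial_div_eq_factorialUnit, Finset.prod_mul_distrib]
    rw [hpw, ← hPe, ← hPf, mul_div_mul_comm, mul_div_mul_comm, div_self hpp, mul_one]
  have hdiv : n / p < p ^ s := Nat.div_lt_of_lt_mul (by rwa [pow_succ'] at hn)
  have hY := factorialRatio_div_dvd (p := p) hsum hlandau m hdiv hr.1
  rw [← hM] at hY
  rw [hratio, show ∀ y : ℚ, Pe / Pf * y - y = y * ((Pe - Pf) / Pf) by intro y; field_simp]
  exact (hY.mul (hEF.div_of_unit hPf1)).mono (by push_cast; omega)

theorem dworkHypotheses_factorialRatio {q₁ q₂ : ℕ} {e : Fin q₁ → ℕ} {f : Fin q₂ → ℕ}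
    (hsum : ∑ i, e i = ∑ j, f j)
    (hlandau : ∀ x : ℝ, 1 / (maxTerm e f : ℝ) ≤ x → x < 1 → 1 ≤ landau e f x) :
    DworkHypotheses p (Exceptional p (maxTerm e f)) (factorialRatio e f)
      (excCount p (maxTerm e f)) where
  map_zero := by simp [factorialRatio]
  ne_zero := factorialRatio_ne_zero e f
  dvd := factorialRatio_dvd hsum hlandau
  gain _ _ m hn hb := hb.add_excCount_le m hn
  dvd_ratio _ _ m hu hr := factorialRatio_div_dvd hsum hlandau m hu hr
  congr_ratio := factorialRatio_congr hsum hlandau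

end Congruence

/-! ### Harmonic numbers and summation by parts over digits. -/

section Harmonic

variable {p : ℕ} [hp : Fact p.Prime] {M L lam : ℕ}

theorem harmonic_add_sub (a c : ℕ) :
    harmonic (a + c) - harmonic a = ∑ i ∈ Finset.range c, ((a + i + 1 : ℕ) : ℚ)⁻¹ := by
  rw [harmonic, harmonic, Finset.sum_range_add, add_sub_cancel_left]

/-- The increment is a sum of `1 / x` with `L ⌊m / p⌋ p^(s + 1) < x ≤ L m p^s`. A large valuation of
`x` makes `m` exceptional, hence is paid for by `excCount p M m`. -/
theorem harmonic_sub_dvd (hL0 : 0 < L) (hL : p ^ lam * L ≤ M) (s m : ℕ) :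
    PDvd p ((lam : ℤ) - s - excCount p M m)
      (harmonic (L * (m * p ^ s)) - harmonic (L * (m / p * p ^ (s + 1)))) := by
  have hle : L * (m / p * p ^ (s + 1)) ≤ L * (m * p ^ s) := by
    rw [pow_succ', ← mul_assoc (m / p)]
    exact Nat.mul_le_mul_left _ (Nat.mul_le_mul_right _ (Nat.div_mul_le_self m p))
  obtain ⟨c, hc⟩ := Nat.exists_eq_add_of_le hle
  rw [hc, harmonic_add_sub]
  refine PDvd.sum fun i hi => ?_
  have hi' := Finset.mem_range.1 hi
  set x := L * (m / p * p ^ (s + 1)) + i + 1 with hx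
  have hx0 : x ≠ 0 := by omega
  have hxb : x ≤ L * (m * p ^ s) := by omega
  have hm : m ≠ 0 := by rintro rfl; simp at hxb
  have hnd : ¬ p ^ (padicValNat p x + 1) ∣ x := pow_succ_padicValNat_not_dvd hx0
  have key : padicValNat p x + lam ≤ s + excCount p M m := by
    -- If `v_p(x) = s + k`, then `exceptional_of_pow_dvd` for `x / p^s` gives `k + lam ≤ excCount p
    -- M m`. If `v_p(x) ≤ s`, the bound `lam ≤ excCount p M m`, valid as `m ≠ 0`, is enough.
    rcases le_total s (padicValNat p x) with hs | hs
    · obtain ⟨k, hk⟩ := Nat.exists_eq_add_of_le hs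
      obtain ⟨y, hy⟩ : p ^ (s + k) ∣ x := by rw [← hk]; exact pow_padicValNat_dvd
      have hps := pow_pos hp.out.pos s
      have h1 : x = p ^ s * (p ^ k * y) := by rw [hy]; ring
      have := (exceptional_of_pow_dvd (p := p) (M := M) (L := L) (n := m) (k := k)
        (x := p ^ k * y) hL ?_ ?_ (Dvd.intro _ rfl)).le_excCount
      · omega
      · refine lt_of_mul_lt_mul_left (a := p ^ s) ?_ (Nat.zero_le _)
        rw [← h1, hx, show p ^ s * (L * (p * (m / p))) = L * (m / p * p ^ (s + 1)) by ring]
        omega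
      · refine le_of_mul_le_mul_left (a := p ^ s) ?_ hps
        rw [← h1, show p ^ s * (L * m) = L * (m * p ^ s) by ring]
        exact hxb
    · have := le_excCount hL0 hL m hm
      omega
  exact (PDvd.inv_natCast hx0 hnd).mono (by omega)

/-- The multiples of `p` in `p H_{N p}` reproduce `H_N`; what is left is `p` times a sum of inverses
of units. -/
theorem prime_mul_harmonic_sub (N : ℕ) :
    PDvd p 1 ((p : ℚ) * harmonic (N * p) - harmonic N) := by
  obtain ⟨r, hr⟩ : ∃ r, p = r + 1 := ⟨p - 1, by have := hp.out.pos; omega⟩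
  have hp0 : (p : ℚ) ≠ 0 := by exact_mod_cast hp.out.ne_zero
  rw [harmonic, harmonic, sum_range_mul_eq, Finset.mul_sum, ← Finset.sum_sub_distrib]
  refine PDvd.sum fun b _ => ?_
  have h1 : ∑ i ∈ Finset.range p, ((i + b * p + 1 : ℕ) : ℚ)⁻¹ =
      ∑ i ∈ Finset.range r, ((i + b * p + 1 : ℕ) : ℚ)⁻¹ + (((b + 1) * p : ℕ) : ℚ)⁻¹ := by
    conv_lhs => rw [hr]
    rw [Finset.sum_range_succ, show r + b * (r + 1) + 1 = (b + 1) * (r + 1) by ring, ← hr]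
  have h2 : (p : ℚ) * (((b + 1) * p : ℕ) : ℚ)⁻¹ = ((b + 1 : ℕ) : ℚ)⁻¹ := by
    push_cast; field_simp
  rw [h1, mul_add, h2, add_sub_cancel_right]
  refine PDvd.mul_right PDvd.prime (PDvd.sum fun i hi => ?_)
  have hi' := Finset.mem_range.1 hi
  have := PDvd.inv_natCast (p := p) (m := i + b * p + 1) (t := 0) (by omega) ?_
  · simpa using this
  · rw [zero_add, pow_one, add_right_comm]
    intro h
    have := Nat.le_of_dvd (by omega) ((Nat.dvd_add_left (Dvd.intro_left b rfl)).1 h)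
    omega

variable {A : ℕ → ℚ}

/-- Pass through `p H_{L j p}`: the increment from `L j p` to `L (a + j p)` is `harmonic_sub_dvd` at
`s = 0`. The rest is divisible by `p`, and `A (a + j p)` supplies `p^lam` unless `a + j p = 0`,
where it vanishes. -/
theorem mul_harmonic_sub_dvd (hA : ∀ n, PDvd p (excCount p M n) (A n)) (hL0 : 0 < L)
    (hL : p ^ lam * L ≤ M) {a : ℕ} (ha : a < p) (j : ℕ) :
    PDvd p ((lam : ℤ) + 1)
      (A (a + j * p) * ((p : ℚ) * harmonic (L * (a + j * p)) - harmonic (L * j))) := by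
  set n := a + j * p with hn
  have hj : n / p = j := by
    rw [hn, Nat.add_mul_div_right _ _ hp.out.pos, Nat.div_eq_of_lt ha, zero_add]
  have h1 := ((harmonic_sub_dvd hL0 hL 0 n).mul (hA n)).mul (PDvd.prime (p := p))
  rw [hj, pow_zero, mul_one, zero_add, pow_one] at h1
  have h2 : PDvd p ((lam : ℤ) + 1)
      (A n * ((p : ℚ) * harmonic (L * j * p) - harmonic (L * j))) := by
    by_cases h0 : n = 0
    · have hj0 : j = 0 := by rw [← hj, h0, Nat.zero_div]
      rw [hj0]; simpa using PDvd.zero _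
    · have := le_excCount hL0 hL n h0
      exact ((hA n).mono (by omega)).mul (prime_mul_harmonic_sub (L * j))
  have := (h1.mono (l := (lam : ℤ) + 1) (by simp)).add h2
  convert this using 1
  rw [mul_assoc L j p]; ring

/-- Replacing `m` by `⌊m / p⌋` in the harmonic factor and grouping gives the same sum one level up.
The error at level `s` pairs a valuation `lam - s - μ m` with `s + 1 + μ m`. After `u` steps only
`H_0 = 0` remains. -/
theorem sum_harmonic_mul_dworkSum {Bad : ℕ → ℕ → Prop}
    (h : DworkHypotheses p Bad A (excCount p M)) (hL0 : 0 < L)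
    (hL : p ^ lam * L ≤ M) {a : ℕ} (ha : a < p) (K u : ℕ) : ∀ s : ℕ,
    PDvd p ((lam : ℤ) + 1)
      (∑ m ∈ Finset.range (p ^ u), harmonic (L * (m * p ^ s)) * dworkSum p A a K s m) := by
  induction u with
  | zero => intro s; simpa using PDvd.zero _
  | succ u ih =>
    intro s
    have h1 : ∑ m ∈ Finset.range (p ^ u), harmonic (L * (m * p ^ (s + 1))) *
        dworkSum p A a K (s + 1) m = ∑ m ∈ Finset.range (p ^ (u + 1)),
          harmonic (L * (m / p * p ^ (s + 1))) * dworkSum p A a K s m := by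
      rw [pow_succ p u, sum_range_mul_eq]
      refine Finset.sum_congr rfl fun c _ => ?_
      rw [dworkSum_succ, Finset.mul_sum]
      refine Finset.sum_congr rfl fun b hb => ?_
      rw [DworkHypotheses.digit_div (Finset.mem_range.1 hb)]
    have h2 : PDvd p ((lam : ℤ) + 1) (∑ m ∈ Finset.range (p ^ (u + 1)),
        (harmonic (L * (m * p ^ s)) - harmonic (L * (m / p * p ^ (s + 1)))) *
          dworkSum p A a K s m) :=
      PDvd.sum fun m _ =>
        ((harmonic_sub_dvd hL0 hL s m).mul (h.dworkSum_dvd ha s K m)).mono (by omega)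
    have h3 := h2.add (ih (s + 1))
    rw [h1, ← Finset.sum_add_distrib] at h3
    simpa only [← add_mul, sub_add_cancel] using h3

theorem sum_mul_harmonic_sub_dvd {Bad : ℕ → ℕ → Prop}
    (h : DworkHypotheses p Bad A (excCount p M)) (hL0 : 0 < L)
    (hL : p ^ lam * L ≤ M) {a : ℕ} (ha : a < p) (K : ℕ) :
    PDvd p ((lam : ℤ) + 1) (∑ j ∈ Finset.range (K + 1), A (K - j) * A (a + j * p) *
      (harmonic (L * (K - j)) - (p : ℚ) * harmonic (L * (a + j * p)))) := by
  -- Since `K < p^K`, `K` digits suffice to cover all `j ≤ K`.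
  have h1 := sum_harmonic_mul_dworkSum h hL0 hL ha K K 0
  have h2 : ∑ m ∈ Finset.range (p ^ K), harmonic (L * (m * p ^ 0)) * dworkSum p A a K 0 m =
      ∑ j ∈ Finset.range (K + 1), harmonic (L * j) *
        (A (a + j * p) * A (K - j) - A j * A (a + (K - j) * p)) := by
    symm
    refine Finset.sum_subset_zero_on_sdiff
      (Finset.range_mono (Nat.lt_pow_self hp.out.one_lt)) (fun j hj => ?_) fun j hj => ?_
    · have : ¬ j ≤ K := by
        have := (Finset.mem_sdiff.1 hj).2
        simpa [Nat.lt_succ_iff] using this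
      rw [dworkSum_zero, dworkTerm, if_neg this, mul_zero]
    · have : j ≤ K := by simpa [Nat.lt_succ_iff] using hj
      rw [dworkSum_zero, dworkTerm, if_pos this, pow_zero, mul_one]
  have h3 : ∑ j ∈ Finset.range (K + 1), harmonic (L * j) * (A j * A (a + (K - j) * p)) =
      ∑ j ∈ Finset.range (K + 1), harmonic (L * (K - j)) * (A (K - j) * A (a + j * p)) := by
    rw [← Finset.sum_flip]
    refine Finset.sum_congr rfl fun j hj => ?_
    rw [Nat.sub_sub_self (by simpa [Nat.lt_succ_iff] using hj)]
  rw [h2] at h1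
  simp only [mul_sub, Finset.sum_sub_distrib] at h1
  rw [h3, ← Finset.sum_sub_distrib] at h1
  have h4 : PDvd p ((lam : ℤ) + 1) (∑ j ∈ Finset.range (K + 1), A (K - j) *
      (A (a + j * p) * ((p : ℚ) * harmonic (L * (a + j * p)) - harmonic (L * j)))) :=
    PDvd.sum fun j _ =>
      (mul_harmonic_sub_dvd h.dvd hL0 hL ha j).mul_left (h.integral _)
  have h5 := (h1.add h4).neg
  rw [← Finset.sum_add_distrib, ← Finset.sum_neg_distrib] at h5
  convert h5 using 2
  ring

end Harmonic

/-! ### Exponentials of power series. -/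

section ExpSubst

theorem constantCoeff_exp_subst {h : ℚ⟦X⟧} (hh : constantCoeff h = 0) :
    constantCoeff ((exp ℚ).subst h : ℚ⟦X⟧) = 1 := by
  have hs : HasSubst h := HasSubst.of_constantCoeff_zero' hh
  have h1 : constantCoeff ((exp ℚ - 1).subst h : ℚ⟦X⟧) = 0 :=
    constantCoeff_subst_eq_zero hh _ (by simp)
  rw [subst_sub hs, map_sub, sub_eq_zero] at h1
  refine Eq.trans h1 ?_
  rw [← coe_substAlgHom hs, map_one]
  exact map_one _

theorem derivative_exp_subst {h : ℚ⟦X⟧} (hh : constantCoeff h = 0) :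
    derivative ℚ ((exp ℚ).subst h : ℚ⟦X⟧) = (exp ℚ).subst h * derivative ℚ h := by
  rw [derivative_subst (HasSubst.of_constantCoeff_zero' hh), derivative_exp]

theorem exp_subst_add {a b : ℚ⟦X⟧} (ha : constantCoeff a = 0) (hb : constantCoeff b = 0) :
    ((exp ℚ).subst (a + b) : ℚ⟦X⟧) = (exp ℚ).subst a * (exp ℚ).subst b := by
  have hab : constantCoeff (a + b) = 0 := by rw [map_add, ha, hb, add_zero]
  set y := ((exp ℚ).subst (a + b) : ℚ⟦X⟧) with hy
  set z := ((exp ℚ).subst a * (exp ℚ).subst b : ℚ⟦X⟧) with hz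
  have hz1 : constantCoeff z = 1 := by
    rw [hz, map_mul, constantCoeff_exp_subst ha, constantCoeff_exp_subst hb, one_mul]
  have hzz : z * z⁻¹ = 1 := PowerSeries.mul_inv_cancel z (by rw [hz1]; exact one_ne_zero)
  have hdy : derivative ℚ y = y * (derivative ℚ a + derivative ℚ b) := by
    rw [hy, derivative_exp_subst hab, map_add]
  have hdz : derivative ℚ z = z * (derivative ℚ a + derivative ℚ b) := by
    rw [hz, Derivation.leibniz, derivative_exp_subst ha, derivative_exp_subst hb]
    simp only [smul_eq_mul]; ring
  -- Both series have the same logarithmic derivative, so their quotient has derivative zero and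
  -- constant term `1`.
  have h1 : y * z⁻¹ = 1 := by
    refine derivative.ext ?_ ?_
    · rw [Derivation.leibniz, derivative_inv', hdy, hdz, derivative_one]
      simp only [smul_eq_mul]
      linear_combination (-y * z⁻¹ * (derivative ℚ a + derivative ℚ b)) * hzz
    · rw [map_mul, constantCoeff_inv, hz1, hy, constantCoeff_exp_subst hab]; simp
  calc y = y * z⁻¹ * z := by rw [mul_assoc, mul_comm z⁻¹, hzz, mul_one]
    _ = z := by rw [h1, one_mul]

theorem exp_subst_nsmul {h : ℚ⟦X⟧} (hh : constantCoeff h = 0) (n : ℕ) :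
    ((exp ℚ).subst (n • h) : ℚ⟦X⟧) = ((exp ℚ).subst h : ℚ⟦X⟧) ^ n := by
  induction n with
  | zero =>
    have h0 : constantCoeff (0 : ℚ⟦X⟧) = 0 := map_zero _
    rw [zero_smul, pow_zero]
    refine derivative.ext ?_ ?_
    · rw [derivative_exp_subst h0, map_zero, mul_zero, derivative_one]
    · rw [constantCoeff_exp_subst h0, map_one]
  | succ n ih =>
    rw [succ_nsmul, exp_subst_add (by rw [map_nsmul, hh, smul_zero]) hh, ih, pow_succ]

end ExpSubst

/-! ### Dwork's integrality criterion for exponentials. -/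

section Integrality

variable {p : ℕ} [hp : Fact p.Prime]

theorem PDvd.coeff_mul {k l : ℤ} {φ ψ : ℚ⟦X⟧} (hφ : ∀ n, PDvd p k (coeff n φ))
    (hψ : ∀ n, PDvd p l (coeff n ψ)) (n : ℕ) : PDvd p (k + l) (coeff n (φ * ψ)) := by
  rw [PowerSeries.coeff_mul]
  exact PDvd.sum fun x _ => (hφ _).mul (hψ _)

theorem PDvd.coeff_one (n : ℕ) : PDvd p 0 (coeff n (1 : ℚ⟦X⟧)) := by
  rw [PowerSeries.coeff_one]
  split_ifs
  · exact PDvd.one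
  · exact PDvd.zero 0

theorem PDvd.coeff_pow {φ : ℚ⟦X⟧} (hφ : ∀ n, PDvd p 1 (coeff n φ)) (d : ℕ) :
    ∀ n, PDvd p d (coeff n (φ ^ d)) := by
  induction d with
  | zero => intro n; rw [pow_zero]; exact PDvd.coeff_one n
  | succ d ih =>
    intro n
    rw [pow_succ]
    exact_mod_cast PDvd.coeff_mul ih hφ n

theorem PDvd.coeff_inv {φ : ℚ⟦X⟧} (hφ : ∀ n, PDvd p 0 (coeff n φ))
    (h1 : constantCoeff φ = 1) (n : ℕ) : PDvd p 0 (coeff n φ⁻¹) := by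
  induction n using Nat.strong_induction_on with
  | _ n ih =>
  rw [PowerSeries.coeff_inv, h1]
  split_ifs with hn
  · rw [inv_one]; exact PDvd.one
  · rw [inv_one, neg_one_mul]
    refine PDvd.neg (PDvd.sum fun x _ => ?_)
    split_ifs with hx
    · exact (ih _ hx).mul_left (hφ _)
    · exact PDvd.zero 0

theorem PDvd.coeff_expand {k : ℤ} {φ : ℚ⟦X⟧} (hφ : ∀ n, PDvd p k (coeff n φ)) (n : ℕ) :
    PDvd p k (coeff n (expand p hp.out.ne_zero φ)) := by
  rw [PowerSeries.coeff_expand]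
  split_ifs
  · exact hφ _
  · exact PDvd.zero k

/-- If all coefficients of `w` are divisible by `p`, so are those of `exp w - 1`. -/
theorem PDvd.coeff_exp_subst_sub_one {w : ℚ⟦X⟧} (hw0 : constantCoeff w = 0)
    (hw : ∀ n, PDvd p 1 (coeff n w)) (n : ℕ) :
    PDvd p 1 (coeff n ((exp ℚ - 1).subst w : ℚ⟦X⟧)) := by
  rw [coeff_subst' (HasSubst.of_constantCoeff_zero' hw0)]
  refine finsum_induction (PDvd p 1) (PDvd.zero 1) (fun _ _ => PDvd.add) fun d => ?_
  rw [smul_eq_mul, map_sub, coeff_exp, PowerSeries.coeff_one]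
  split_ifs with hd
  · subst hd; simpa using PDvd.zero 1
  · have h1 := sub_one_mul_padicValNat_factorial_lt_of_ne_zero p hd
    have h2 : padicValNat p d.factorial ≤ (p - 1) * padicValNat p d.factorial :=
      Nat.le_mul_of_pos_left _ (by have := hp.out.two_le; omega)
    have h3 := PDvd.inv_natCast (p := p) (m := d.factorial) (Nat.factorial_ne_zero d)
      (pow_succ_padicValNat_not_dvd (Nat.factorial_ne_zero d))
    have h4 := h3.mul (PDvd.coeff_pow hw d n)
    simp only [one_div, sub_zero, eq_ratCast, Rat.cast_id]
    exact h4.mono (by omega)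

end Integrality

/-- **Dwork's lemma**: a criterion for the integrality of the exponential of a power series. -/
theorem exists_int_coeff_exp_subst {h : ℚ⟦X⟧} (h0 : constantCoeff h = 0)
    (hint : ∀ (p : ℕ) (hp : p.Prime) (n : ℕ),
      PDvd p 1 (coeff n (expand p hp.ne_zero h - p • h))) (n : ℕ) :
    ∃ z : ℤ, (z : ℚ) = coeff n ((exp ℚ).subst h : ℚ⟦X⟧) := by
  set φ := ((exp ℚ).subst h : ℚ⟦X⟧) with hφ
  have hφ1 : constantCoeff φ = 1 := constantCoeff_exp_subst h0
  induction n using Nat.strong_induction_on with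
  | _ n ih =>
  rcases Nat.eq_zero_or_pos n with rfl | hn
  · exact ⟨1, by rw [coeff_zero_eq_constantCoeff_apply, hφ1, Int.cast_one]⟩
  refine exists_intCast_eq_of_forall_pDvd fun p hp => ?_
  have : Fact p.Prime := ⟨hp⟩
  set w := expand p hp.ne_zero h - p • h with hw
  have hw0 : constantCoeff w = 0 := by
    rw [hw, map_sub, map_nsmul, h0, constantCoeff_expand, h0]; simp
  set v := ((exp ℚ - 1).subst w : ℚ⟦X⟧) with hv
  have hv1 : ∀ i, PDvd p 1 (coeff i v) := PDvd.coeff_exp_subst_sub_one hw0 (hint p hp)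
  have hv0 : constantCoeff v = 0 := constantCoeff_subst_eq_zero hw0 _ (by simp)
  have hew : ((exp ℚ).subst w : ℚ⟦X⟧) = 1 + v := by
    have hs := HasSubst.of_constantCoeff_zero' hw0
    rw [hv, subst_sub hs, ← coe_substAlgHom hs, map_one, add_sub_cancel]
  -- This is the exponential of `h(z^p) = p h + w`. Comparing coefficients of `z^n` isolates `p`
  -- times the `n`-th coefficient of `φ`.
  have hexp : expand p hp.ne_zero φ = φ ^ p * (1 + v) := by
    rw [hφ, expand_apply, subst_comp_subst_apply (HasSubst.of_constantCoeff_zero' h0)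
      (HasSubst.X_pow hp.ne_zero), ← expand_apply p hp.ne_zero h, ← exp_subst_nsmul h0, ← hew,
      ← exp_subst_add (by rw [map_nsmul, h0, smul_zero]) hw0, hw, add_sub_cancel]
  -- The coefficients below `n` are integers by induction, so taking numerators loses nothing.
  set g : Polynomial ℤ := trunc n (PowerSeries.mk fun i => (coeff i φ).num) with hg
  set G : ℚ⟦X⟧ := PowerSeries.map (Int.castRingHom ℚ) (g : ℤ⟦X⟧) with hG
  have hGi : ∀ i < n, coeff i G = coeff i φ := by
    intro i hi
    obtain ⟨z, hz⟩ := ih i hi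
    rw [hG, coeff_map, Polynomial.coeff_coe, hg, coeff_trunc, if_pos hi, coeff_mk, ← hz]
    simp
  obtain ⟨r, hr⟩ : (X : ℚ⟦X⟧) ^ n ∣ φ - G := by
    rw [X_pow_dvd_iff]
    intro i hi
    rw [map_sub, hGi i hi, sub_self]
  have hGn : coeff n G = 0 := by
    rw [hG, coeff_map, Polynomial.coeff_coe, hg, coeff_trunc, if_neg (lt_irrefl n), map_zero]
  have hG0 : constantCoeff G = 1 := by
    rw [← coeff_zero_eq_constantCoeff_apply, hGi 0 hn, coeff_zero_eq_constantCoeff_apply, hφ1]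
  have hrn : constantCoeff r = coeff n φ := by
    have h1 := congrArg (coeff n) hr
    rw [map_sub, hGn, sub_zero, coeff_X_pow_mul', if_pos le_rfl, Nat.sub_self] at h1
    rw [h1, coeff_zero_eq_constantCoeff_apply]
  -- As `n > 0`, the terms quadratic in `X^n r` do not reach degree `n`.
  obtain ⟨k, hk⟩ := Polynomial.powAddExpansion G (X ^ n * r) p
  have hφG : φ ^ p = G ^ p + X ^ n * ((p : ℚ⟦X⟧) * G ^ (p - 1) * r + k * r * r * X ^ n) := by
    rw [show φ = G + X ^ n * r by rw [← hr]; ring, hk]; ring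
  have hcoeff : coeff n (φ ^ p) = coeff n (G ^ p) + p * coeff n φ := by
    rw [hφG, map_add, coeff_X_pow_mul', if_pos le_rfl, Nat.sub_self,
      coeff_zero_eq_constantCoeff_apply]
    simp [hG0, hrn, hn.ne']
  have hGpow : ∀ i, ∃ z : ℤ, coeff i (G ^ p) = z := fun i =>
    ⟨coeff i ((g : ℤ⟦X⟧) ^ p), by rw [hG, ← map_pow, coeff_map]; rfl⟩
  -- Since `v` has no constant term, only coefficients of `φ^p` below `n` occur, and these agree
  -- with those of the integral series `G^p`.
  have hφv : PDvd p 1 (coeff n (φ ^ p * v)) := by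
    rw [PowerSeries.coeff_mul]
    refine PDvd.sum fun x hx => ?_
    have hx' := Finset.HasAntidiagonal.mem_antidiagonal.1 hx
    by_cases hx2 : x.2 = 0
    · rw [hx2, coeff_zero_eq_constantCoeff_apply, hv0, mul_zero]; exact PDvd.zero 1
    · refine (hv1 _).mul_left ?_
      rw [hφG, map_add, coeff_X_pow_mul', if_neg (by omega), add_zero]
      obtain ⟨z, hz⟩ := hGpow x.1
      rw [hz]; exact PDvd.intCast z
  have hdiff : PDvd p 1 (coeff n (expand p hp.ne_zero φ) - coeff n (G ^ p)) := by
    have h1 : coeff n (expand p hp.ne_zero φ) = (((Polynomial.expand ℤ p g).coeff n : ℤ) : ℚ) := by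
      rw [PowerSeries.coeff_expand, Polynomial.coeff_expand hp.pos]
      split_ifs with hd
      · rw [← hGi _ (Nat.div_lt_self hn hp.one_lt), hG, coeff_map, Polynomial.coeff_coe]; rfl
      · simp
    have h2 : coeff n (G ^ p) = (((g ^ p).coeff n : ℤ) : ℚ) := by
      rw [hG, ← map_pow, coeff_map, ← Polynomial.coe_pow, Polynomial.coeff_coe]; rfl
    rw [h1, h2, ← Int.cast_sub]
    have h3 := (PDvd.intCast_iff (p := p) (n := 1)
      (z := (Polynomial.expand ℤ p g).coeff n - (g ^ p).coeff n)).2 ?_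
    · exact_mod_cast h3
    -- Frobenius modulo `p`: `g(z^p)` and `g(z)^p` agree over `ZMod p`.
    · rw [pow_one, ← ZMod.intCast_zmod_eq_zero_iff_dvd, Int.cast_sub, sub_eq_zero]
      have h4 := congrArg (fun q => Polynomial.coeff q n)
        (ZMod.expand_card (p := p) (g.map (Int.castRingHom (ZMod p))))
      rw [← Polynomial.map_expand, ← Polynomial.map_pow] at h4
      simpa only [Polynomial.coeff_map, eq_intCast] using h4
  have hfinal : (p : ℚ) ^ 1 * coeff n φ =
      (coeff n (expand p hp.ne_zero φ) - coeff n (G ^ p)) - coeff n (φ ^ p * v) := by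
    rw [hexp, mul_add, mul_one, map_add, hcoeff]; ring
  have h5 := hdiff.sub hφv
  rw [← hfinal] at h5
  simpa using h5.of_mul_prime_pow

/-! ### The criterion for `θ⁻¹ G / F`, and the root. -/

theorem coeff_mul_expand {p : ℕ} (hp : p ≠ 0) (φ ψ : ℚ⟦X⟧) {a : ℕ} (ha : a < p) (K : ℕ) :
    coeff (a + K * p) (φ * expand p hp ψ) =
      ∑ j ∈ Finset.range (K + 1), coeff (a + (K - j) * p) φ * coeff j ψ := by
  have hp0 : 0 < p := Nat.pos_of_ne_zero hp
  rw [mul_comm φ, PowerSeries.coeff_mul, Finset.Nat.sum_antidiagonal_eq_sum_range_succ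
    (f := fun i j => coeff i (expand p hp ψ) * coeff j φ)]
  have h1 : ∑ k ∈ Finset.range (a + K * p).succ,
      coeff k (expand p hp ψ) * coeff (a + K * p - k) φ =
        ∑ k ∈ Finset.range ((K + 1) * p),
          coeff k (expand p hp ψ) * coeff (a + K * p - k) φ := by
    refine Finset.sum_subset (Finset.range_mono ?_) fun k hk hk' => ?_
    · rw [add_mul]; omega
    · have h2 : k < (K + 1) * p := Finset.mem_range.1 hk
      have h3 : a + K * p < k := by simpa [Nat.lt_succ_iff] using hk'
      rw [coeff_expand_of_not_dvd, zero_mul]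
      rintro ⟨c, rfl⟩
      rw [mul_comm p c] at h2 h3
      have h4 : c < K + 1 := lt_of_mul_lt_mul_right h2 (Nat.zero_le _)
      have h5 : c * p ≤ K * p := Nat.mul_le_mul_right p (by omega)
      omega
  rw [h1, sum_range_mul_eq]
  refine Finset.sum_congr rfl fun j hj => ?_
  have hj' : j ≤ K := by simpa [Nat.lt_succ_iff] using hj
  rw [Finset.sum_eq_single 0]
  · rw [zero_add, mul_comm j p, coeff_expand_mul, mul_comm, Nat.sub_mul, mul_comm j p,
      Nat.add_sub_assoc]
    rw [mul_comm]; exact Nat.mul_le_mul_right p hj'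
  · intro i hi hi0
    rw [coeff_expand_of_not_dvd, zero_mul]
    intro hd
    have := Nat.le_of_dvd (Nat.pos_of_ne_zero hi0)
      ((Nat.dvd_add_left (Dvd.intro_left j rfl)).1 hd)
    have := Finset.mem_range.1 hi
    omega
  · intro h; exact absurd (Finset.mem_range.2 hp0) h

section Root

variable {q₁ q₂ : ℕ} {e : Fin q₁ → ℕ} {f : Fin q₂ → ℕ}

/-- The `p`-part of `θ / gcd(L, θ)` times `L` is at most the maximal term. -/
theorem pow_padicValNat_mul_le {p : ℕ} [hp : Fact p.Prime] {L θ : ℕ} (hL0 : 0 < L)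
    (hL : L ≤ maxTerm e f) (hD : θ / Nat.gcd L θ ∣ lcmUpTo e f L) :
    p ^ padicValNat p (θ / Nat.gcd L θ) * L ≤ maxTerm e f := by
  have hML : 0 < maxTerm e f / L := Nat.div_pos hL hL0
  have h1 : p ^ padicValNat p (θ / Nat.gcd L θ) ∣ Nat.lcmUpto (maxTerm e f / L) :=
    pow_padicValNat_dvd.trans hD
  have h2 := (hp.out.pow_dvd_iff_le_factorization (Nat.lcmUpto_ne_zero _)).1 h1
  -- The exponent of `p` in `lcm(1, …, N)` is `⌊log_p N⌋`, so a power of `p` dividing it is at most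
  -- `N = ⌊M / L⌋`.
  rw [Nat.factorization_lcmUpto _ hp.out] at h2
  rw [← Nat.le_div_iff_mul_le hL0]
  exact Nat.pow_le_of_le_log hML.ne' h2

theorem pDvd_div_of_padicValNat {p : ℕ} [hp : Fact p.Prime] {L θ : ℕ} (hθ : 0 < θ) :
    PDvd p (-(padicValNat p (θ / Nat.gcd L θ) : ℤ)) ((L : ℚ) / θ) := by
  have hg : 0 < Nat.gcd L θ := Nat.gcd_pos_of_pos_right L hθ
  have h0 : θ / Nat.gcd L θ ≠ 0 :=
    (Nat.div_pos (Nat.le_of_dvd hθ (Nat.gcd_dvd_right L θ)) hg).ne'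
  have h1 : (L : ℚ) / θ = ((L / Nat.gcd L θ : ℕ) : ℚ) * ((θ / Nat.gcd L θ : ℕ) : ℚ)⁻¹ := by
    rw [Nat.cast_div (Nat.gcd_dvd_left L θ) (by exact_mod_cast hg.ne'),
      Nat.cast_div (Nat.gcd_dvd_right L θ) (by exact_mod_cast hg.ne')]
    have : ((Nat.gcd L θ : ℕ) : ℚ) ≠ 0 := by exact_mod_cast hg.ne'
    have : (θ : ℚ) ≠ 0 := by exact_mod_cast hθ.ne'
    field_simp
  rw [h1]
  exact (PDvd.inv_natCast h0 (pow_succ_padicValNat_not_dvd h0)).mul_left (PDvd.natCast _)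

theorem coeff_seriesF_mul_expand_sub (p : ℕ) [hp : Fact p.Prime] (he : ∀ i, 0 < e i)
    (hf : ∀ j, 0 < f j) (hsum : ∑ i, e i = ∑ j, f j)
    (hlandau : ∀ x : ℝ, 1 / (maxTerm e f : ℝ) ≤ x → x < 1 → 1 ≤ landau e f x)
    {θ : ℕ} (hθ : 1 ≤ θ)
    (hD : ∀ L : ℕ, L ∈ Set.range e ∪ Set.range f → θ / Nat.gcd L θ ∣ lcmUpTo e f L) (n : ℕ) :
    PDvd p 1 ((θ : ℚ)⁻¹ * coeff n (seriesF e f * expand p hp.out.ne_zero (seriesG e f) -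
      p • (seriesG e f * expand p hp.out.ne_zero (seriesF e f)))) := by
  set A := factorialRatio e f with hA
  set a := n % p with ha
  set K := n / p with hK
  have hap : a < p := Nat.mod_lt n hp.out.pos
  have hn : n = a + K * p := by rw [ha, hK, mul_comm]; exact (Nat.mod_add_div n p).symm
  set T : ℕ → ℚ := fun L => ∑ j ∈ Finset.range (K + 1), A (K - j) * A (a + j * p) *
      (harmonic (L * (K - j)) - (p : ℚ) * harmonic (L * (a + j * p))) with hT
  have hdvd : ∀ L, 0 < L → L ≤ maxTerm e f → θ / Nat.gcd L θ ∣ lcmUpTo e f L →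
      PDvd p 1 ((L : ℚ) / θ * T L) := by
    intro L hL0 hL hLD
    have h1 := sum_mul_harmonic_sub_dvd (dworkHypotheses_factorialRatio (p := p) hsum hlandau)
      hL0 (pow_padicValNat_mul_le (p := p) hL0 hL hLD) hap K
    exact ((pDvd_div_of_padicValNat (p := p) (L := L) hθ).mul h1).mono (by omega)
  -- Harmonic numbers enter `G` linearly, so the coefficient splits into one sum `T L` for each term
  -- `L`.
  have h2 : coeff n (seriesF e f * expand p hp.out.ne_zero (seriesG e f) -
      p • (seriesG e f * expand p hp.out.ne_zero (seriesF e f))) =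
        ∑ i, (e i : ℚ) * T (e i) - ∑ j, (f j : ℚ) * T (f j) := by
    rw [hn, map_sub, map_nsmul, coeff_mul_expand _ _ _ hap, coeff_mul_expand _ _ _ hap,
      ← Finset.sum_flip, ← Finset.sum_flip (fun j => coeff _ (seriesG e f) * _)]
    simp only [hT, seriesF, seriesG, coeff_mk, ← hA, Finset.mul_sum]
    rw [Finset.sum_comm, Finset.sum_comm (s := (Finset.univ : Finset (Fin q₂))),
      ← Finset.sum_sub_distrib, nsmul_eq_mul, Finset.mul_sum, ← Finset.sum_sub_distrib]
    refine Finset.sum_congr rfl fun j hj => ?_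
    rw [Nat.sub_sub_self (by simpa [Nat.lt_succ_iff] using hj)]
    have h3 : ∀ {q : ℕ} (c : Fin q → ℕ), ∑ i, (c i : ℚ) * (A (K - j) * A (a + j * p) *
        (harmonic (c i * (K - j)) - (p : ℚ) * harmonic (c i * (a + j * p)))) =
        A (K - j) * A (a + j * p) * (∑ i, (c i : ℚ) * harmonic (c i * (K - j)) -
          p * ∑ i, (c i : ℚ) * harmonic (c i * (a + j * p))) := by
      intro q c
      rw [Finset.mul_sum, ← Finset.sum_sub_distrib, Finset.mul_sum]
      exact Finset.sum_congr rfl fun i _ => by ring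
    rw [h3, h3]; ring
  rw [h2, mul_sub, Finset.mul_sum, Finset.mul_sum]
  refine PDvd.sub (PDvd.sum fun i _ => ?_) (PDvd.sum fun j _ => ?_)
  · rw [← mul_assoc, mul_comm (θ : ℚ)⁻¹, ← div_eq_mul_inv]
    exact hdvd _ (he i) (le_maxTerm_left e f i) (hD _ (Or.inl ⟨i, rfl⟩))
  · rw [← mul_assoc, mul_comm (θ : ℚ)⁻¹, ← div_eq_mul_inv]
    exact hdvd _ (hf j) (le_maxTerm_right e f j) (hD _ (Or.inr ⟨j, rfl⟩))

/-- Clear denominators: multiplication by the inverses of `F(z)` and `F(z^p)`, which are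
`p`-integral, preserves the divisibility of `coeff_seriesF_mul_expand_sub`. -/
theorem coeff_expand_sub_dvd (p : ℕ) (hp : p.Prime) (he : ∀ i, 0 < e i)
    (hf : ∀ j, 0 < f j) (hsum : ∑ i, e i = ∑ j, f j)
    (hlandau : ∀ x : ℝ, 1 / (maxTerm e f : ℝ) ≤ x → x < 1 → 1 ≤ landau e f x)
    {θ : ℕ} (hθ : 1 ≤ θ)
    (hD : ∀ L : ℕ, L ∈ Set.range e ∪ Set.range f → θ / Nat.gcd L θ ∣ lcmUpTo e f L) (n : ℕ) :
    PDvd p 1 (coeff n (expand p hp.ne_zero ((θ : ℚ)⁻¹ • (seriesG e f * (seriesF e f)⁻¹)) -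
      p • ((θ : ℚ)⁻¹ • (seriesG e f * (seriesF e f)⁻¹)))) := by
  have : Fact p.Prime := ⟨hp⟩
  set F := seriesF e f with hF
  set G := seriesG e f with hG
  have hF1 : constantCoeff F = 1 := constantCoeff_seriesF e f
  have hFF : F * F⁻¹ = 1 := PowerSeries.mul_inv_cancel F (by rw [hF1]; exact one_ne_zero)
  have hFF' : expand p hp.ne_zero F * expand p hp.ne_zero F⁻¹ = 1 := by
    rw [← map_mul, hFF, map_one]
  have hFint : ∀ i, PDvd p 0 (coeff i F) := fun i => by
    rw [hF, seriesF, coeff_mk]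
    exact (factorialRatio_dvd hsum hlandau i).mono (by positivity)
  have hinv := PDvd.coeff_inv hFint hF1
  have hV : ∀ i, PDvd p 1 (coeff i ((θ : ℚ)⁻¹ • (F * expand p hp.ne_zero G -
      p • (G * expand p hp.ne_zero F)))) := fun i => by
    rw [PowerSeries.coeff_smul]
    exact coeff_seriesF_mul_expand_sub p he hf hsum hlandau hθ hD i
  have h1 := PDvd.coeff_mul hV (PDvd.coeff_mul hinv (PDvd.coeff_expand hinv)) n
  rw [add_zero, add_zero] at h1
  convert h1 using 2
  rw [map_smul, map_mul, smul_comm, ← smul_sub, smul_mul_assoc]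
  congr 1
  simp only [nsmul_eq_mul]
  linear_combination (-expand p hp.ne_zero G * expand p hp.ne_zero F⁻¹) * hFF +
    ((p : ℚ⟦X⟧) * G * F⁻¹) * hFF'

end Root

theorem mainTheorem2 {q₁ q₂ : ℕ} (e : Fin q₁ → ℕ) (f : Fin q₂ → ℕ)
    (he : ∀ i, 0 < e i) (hf : ∀ j, 0 < f j)
    (hdisj : ∀ i j, e i ≠ f j)
    (hsum : ∑ i, e i = ∑ j, f j)
    (hlandau : ∀ x : ℝ, 1 / (maxTerm e f : ℝ) ≤ x → x < 1 → 1 ≤ landau e f x)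
    (θ : ℕ) (hθ : 1 ≤ θ) (hθM : θ ∣ maxTerm e f)
    (hD : ∀ L : ℕ, L ∈ Set.range e ∪ Set.range f → θ / Nat.gcd L θ ∣ lcmUpTo e f L) :
    ∃ u : ℚ⟦X⟧, canonicalCoordinate e f = X * u ∧ HasIntegralRoot θ u := by
  refine ⟨_, rfl, ?_⟩
  set h : ℚ⟦X⟧ := (θ : ℚ)⁻¹ • (seriesG e f * (seriesF e f)⁻¹) with hh
  have hθ0 : (θ : ℚ) ≠ 0 := by exact_mod_cast (by omega : θ ≠ 0)
  have h0 : constantCoeff h = 0 := by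
    have hG : constantCoeff (seriesG e f) = 0 := by
      rw [← coeff_zero_eq_constantCoeff_apply]; simp [seriesG]
    rw [hh, ← coeff_zero_eq_constantCoeff_apply, PowerSeries.coeff_smul,
      coeff_zero_eq_constantCoeff_apply, map_mul, hG, zero_mul, smul_zero]
  have hint := exists_int_coeff_exp_subst h0 fun p hp n =>
    coeff_expand_sub_dvd p hp he hf hsum hlandau hθ hD n
  choose z hz using hint
  have hmap : PowerSeries.map (Int.castRingHom ℚ) (PowerSeries.mk z) = (exp ℚ).subst h := by
    ext n
    rw [coeff_map, coeff_mk, ← hz n]; rfl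
  refine ⟨PowerSeries.mk z, ?_, ?_⟩
  · have h1 := hz 0
    rw [coeff_zero_eq_constantCoeff_apply, constantCoeff_exp_subst h0] at h1
    rw [← coeff_zero_eq_constantCoeff_apply, coeff_mk]
    exact_mod_cast h1
  -- The `θ`-th power of `exp h` is `exp (θ h)`, and `θ h = G / F`.
  · rw [hmap, ← exp_subst_nsmul h0, hh, ← Nat.cast_smul_eq_nsmul ℚ, smul_smul,
      mul_inv_cancel₀ hθ0, one_smul]
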